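/- Let $0<\alpha\le 1$ and $\tau>0$. For $x:[0,\infty)\to\mathbb R$ continuous put $I^{0}_{0^+}x:=x$ and $I^{\beta}_{0^+}x(t):=\frac1{\Gamma(\beta)}\int_0^t(t-u)^{\beta-1}x(u)\,du$ for $\beta>0$, and let ${}^{C}D^{\alpha}_{0^+}x(t):=\frac{d}{dt}I^{1-\alpha}_{0^+}(x-x(0))(t)$ be the Caputo derivative of order $\alpha$. Let $E_\alpha(x):=\sum_{k=0}^\infty \frac{x^k}{\Gamma(\alpha k+1)}$ be the Mittag-Leffler function. Let $a,b,c:[0,\infty)\to[0,\infty)$ and $q:[0,\infty)\to[0,\tau]$ be continuous, with $c^*:=\sup_{t\ge0}c(t)<\infty$, and let $\varphi:[-\tau,0]\to[0,\infty)$ be continuous. Let $w:[-\tau,\infty)\to[0,\infty)$ be continuous, such that ${}^{C}D^{\alpha}_{0^+}w(t)$ exists for all $t>0$ and $${}^{C}D^{\alpha}_{0^+}w(t)\le -a(t)w(t)+b(t)\sup_{t-q(t)\le s\le t}w(s)+c(t)\quad(t>0),\qquad w(s)=\varphi(s)\quad(s\in[-\tau,0]).$$ Assume that one of the following two conditions holds: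 (i) $a$ is bounded on $[0,\infty)$ and, for some constant $\sigma>0$, $a(t)-b(t)\ge\sigma$ for all $t\ge0$; (ii) there are constants $a_0>0$ and $p<1$ such that $a(t)\ge a_0$ for all $t\ge0$ and $\sup_{t\ge0}\frac{b(t)}{a(t)}\le p$. Then there are $w_0\ge0$ and $\lambda^*>0$ such that $$w(t)\le w_0+M\,E_\alpha(-\lambda^*t^\alpha)\quad\text{for all }t\ge0,\qquad M:=\sup_{s\in[-\tau,0]}|\varphi(s)|.$$ Moreover, one can take $w_0=c^*/\sigma$ in case (i) and $w_0=c^*/((1-p)a_0)$ in case (ii) (in particular $w_0=0$ if $c\equiv0$), and $\lambda^*$ can be chosen depending only on $\alpha,\tau,a,b,q$ and the constants in the condition ($\sigma$, respectively $a_0$ and $p$), not on $c$, $\varphi$ or $w$. -/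

import Mathlib

open Set

noncomputable section

namespace FracHalanay

/-- The Riemann--Liouville fractional integral with base point `0` and order `β ≥ 0`,
`(1 / Γ(β)) ∫₀ᵗ (t - u) ^ (β - 1) x(u) du` for `β > 0`; the integral of order `0` is the
identity. -/
def rlIntegral (β : ℝ) (x : ℝ → ℝ) (t : ℝ) : ℝ :=
  if β = 0 then x t
  else 1 / Real.Gamma β * ∫ u in (0 : ℝ)..t, (t - u) ^ (β - 1) * x u

/-- The Caputo fractional derivative of order `α ∈ (0, 1]` of `x` exists at `t`. -/
def CaputoDifferentiableAt (α : ℝ) (x : ℝ → ℝ) (t : ℝ) : Prop :=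
  DifferentiableAt ℝ (rlIntegral (1 - α) (fun u => x u - x 0)) t

/-- The Caputo fractional derivative of order `α ∈ (0, 1]` of `x` at `t`, with base point `0`. -/
def caputoDeriv (α : ℝ) (x : ℝ → ℝ) (t : ℝ) : ℝ :=
  deriv (rlIntegral (1 - α) (fun u => x u - x 0)) t

/-- The two-parameter Mittag-Leffler function `E_{α,β}` on the real line
(the series converges absolutely for all `α, β > 0`). -/
def mittagLeffler₂ (α β x : ℝ) : ℝ :=
  ∑' k : ℕ, x ^ k / Real.Gamma (α * k + β)

/-- The classical Mittag-Leffler function `E_α = E_{α,1}`. -/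
def mittagLeffler (α x : ℝ) : ℝ := mittagLeffler₂ α 1 x

/-- `w` is a continuous nonnegative function on `[-τ, ∞)`, with a Caputo derivative of order `α`
on `(0, ∞)`, which satisfies the fractional Halanay inequality with coefficients `a`, `b`, `c`
and delay `q`, and which has the initial data `φ` on `[-τ, 0]`. -/
structure SatisfiesHalanay (α τ : ℝ) (a b c q φ w : ℝ → ℝ) : Prop where
  continuousOn : ContinuousOn w (Ici (-τ))
  nonneg : ∀ t ∈ Ici (-τ), 0 ≤ w t
  caputoDifferentiableAt : ∀ t : ℝ, 0 < t → CaputoDifferentiableAt α w t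
  caputoDeriv_le : ∀ t : ℝ, 0 < t →
    caputoDeriv α w t ≤ -a t * w t + b t * sSup (w '' Icc (t - q t) t) + c t
  initial : ∀ s ∈ Icc (-τ) 0, w s = φ s

end FracHalanay

end

noncomputable section

namespace FracHalanay

open MeasureTheory Filter Topology intervalIntegral

/-! Write k_β for `powKernel β`, r for `mlKernel α α A`, s_A(t) = E_α(-A t^α) for `mlKernel α 1 A`,
and * for `cconv`.

The bound is a barrier argument. For small λ the barrier w₀ + ε + M s_λ lies strictly above w at
time 0. Up to a first contact time T, w is below the barrier on the whole delay window. The delayed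
barrier is controlled by the current one: s_λ(τ) s_λ(t) ≤ s_λ(t + τ) (`mlKernel_one_mul_le`) and
monotonicity of s_λ give s_λ(x) ≤ s_λ(u) / s_λ(τ) for u - τ ≤ x ≤ u. If λ + b / s_λ(τ) ≤ a, the
difference m of w and the barrier satisfies D^α m ≤ -a m on (0, T). There m < 0, so a may be
replaced by an upper bound A on [0, T]. The linear comparison principle then gives m(T) ≤ m(0)
s_A(T) < 0, excluding contact.

Both tools rest on positivity of the resolvent kernel r (`mlKernel_pos`), derived from its Volterra
equation r = k_α - A k_α * r, without complete monotonicity. Since s_A = 1 - A ∫ r, positivity makes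
s_A decreasing. Convolution with r inverts the integrated relaxation operator and preserves signs,
which yields the comparison principle. -/

/-! ### Power kernels and their semigroup law -/

/-- The power kernel `t ^ (β - 1) / Γ(β)` of the Riemann--Liouville integral of order `β`. -/
def powKernel (β t : ℝ) : ℝ := t ^ (β - 1) / Real.Gamma β

/-- The causal convolution `(f * g)(t) = ∫₀ᵗ f(t - u) g(u) du`. -/
def cconv (f g : ℝ → ℝ) (t : ℝ) : ℝ := ∫ u in (0 : ℝ)..t, f (t - u) * g u

/-- The Mittag-Leffler kernel `t ^ (β - 1) E_{α,β}(-A t ^ α)`. -/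
def mlKernel (α β A t : ℝ) : ℝ := t ^ (β - 1) * mittagLeffler₂ α β (-A * t ^ α)

theorem powKernel_pos {β t : ℝ} (hβ : 0 < β) (ht : 0 < t) : 0 < powKernel β t :=
  div_pos (Real.rpow_pos_of_pos ht _) (Real.Gamma_pos_of_pos hβ)

theorem powKernel_nonneg {β t : ℝ} (hβ : 0 < β) (ht : 0 ≤ t) : 0 ≤ powKernel β t :=
  div_nonneg (Real.rpow_nonneg ht _) (Real.Gamma_pos_of_pos hβ).le

theorem powKernel_one (t : ℝ) : powKernel 1 t = 1 := by simp [powKernel]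

theorem intervalIntegrable_powKernel {β : ℝ} (hβ : 0 < β) (a b : ℝ) :
    IntervalIntegrable (powKernel β) volume a b :=
  (intervalIntegrable_rpow' (by linarith)).div_const _

theorem integral_powKernel {β : ℝ} (hβ : 0 < β) (t : ℝ) :
    ∫ u in (0 : ℝ)..t, powKernel β u = powKernel (β + 1) t := by
  simp only [powKernel, intervalIntegral.integral_div]
  rw [integral_rpow (Or.inl (by linarith)), Real.Gamma_add_one hβ.ne', Real.zero_rpow (by linarith)]
  have := (Real.Gamma_pos_of_pos hβ).ne'
  have := hβ.ne'
  simp only [sub_add_cancel, sub_zero, add_sub_cancel_right]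
  field_simp

theorem cconv_comm (f g : ℝ → ℝ) (t : ℝ) : cconv f g t = cconv g f t := by
  unfold cconv
  have := intervalIntegral.integral_comp_sub_left (a := 0) (b := t) (fun u => f (t - u) * g u) t
  simp only [sub_sub_cancel, sub_self, sub_zero] at this
  rw [← this]
  simp [mul_comm]

/-- Euler's beta integral, scaled to [0, t] and transferred from the complex identity. -/
theorem cconv_powKernel {β γ t : ℝ} (hβ : 0 < β) (hγ : 0 < γ) (ht : 0 < t) :
    cconv (powKernel γ) (powKernel β) t = powKernel (β + γ) t := by
  have hre : ((∫ u in (0 : ℝ)..t, u ^ (β - 1) * (t - u) ^ (γ - 1) : ℝ) : ℂ) =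
      ((t ^ (β + γ - 1) * (Real.Gamma β * Real.Gamma γ / Real.Gamma (β + γ)) : ℝ) : ℂ) := by
    have h := Complex.betaIntegral_scaled β γ ht
    rw [Complex.betaIntegral_eq_Gamma_mul_div _ _ (by simpa) (by simpa)] at h
    have h2 : ((t ^ (β + γ - 1) * (Real.Gamma β * Real.Gamma γ / Real.Gamma (β + γ)) : ℝ) : ℂ) =
        (t : ℂ) ^ ((β : ℂ) + γ - 1) *
          (Complex.Gamma β * Complex.Gamma γ / Complex.Gamma (β + γ)) := by
      rw [← Complex.ofReal_add]
      simp_rw [Complex.Gamma_ofReal]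
      push_cast [Complex.ofReal_cpow ht.le]
      rfl
    rw [h2, ← h, ← intervalIntegral.integral_ofReal]
    refine intervalIntegral.integral_congr fun u hu => ?_
    rw [uIcc_of_le ht.le] at hu
    have h1 : 0 ≤ t - u := sub_nonneg.2 hu.2
    push_cast [Complex.ofReal_cpow hu.1, Complex.ofReal_cpow h1]
    rfl
  have hre' := Complex.ofReal_injective hre
  have hb := (Real.Gamma_pos_of_pos hβ).ne'
  have hg := (Real.Gamma_pos_of_pos hγ).ne'
  have hs := (Real.Gamma_pos_of_pos (add_pos hβ hγ)).ne'
  have : cconv (powKernel γ) (powKernel β) t =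
      (∫ u in (0 : ℝ)..t, u ^ (β - 1) * (t - u) ^ (γ - 1)) / (Real.Gamma β * Real.Gamma γ) := by
    rw [cconv, ← intervalIntegral.integral_div]
    refine intervalIntegral.integral_congr fun u _ => ?_
    simp only [powKernel]
    field_simp
  rw [this, hre', powKernel]
  field_simp

theorem intervalIntegrable_powKernel_mul_powKernel {β γ t : ℝ} (hβ : 0 < β) (hγ : 0 < γ)
    (ht : 0 < t) :
    IntervalIntegrable (fun u => powKernel γ (t - u) * powKernel β u) volume 0 t := by
  -- The integral of a non-integrable function is 0 by convention, whereas the beta integral gives a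
  -- positive value.
  by_contra h
  have h1 := cconv_powKernel hβ hγ ht
  rw [cconv, intervalIntegral.integral_undef h] at h1
  exact (powKernel_pos (add_pos hβ hγ) ht).ne h1

/-! ### Mittag-Leffler series and kernels -/

/-- Log-convexity of Γ at x + 1 = α(x + α) + (1 - α)(x + α + 1). The bound is O(x^(-α)), which
drives the ratio test for the Mittag-Leffler series. -/
theorem Gamma_div_Gamma_add_le {α x : ℝ} (hα₀ : 0 < α) (hα₁ : α ≤ 1) (hx : 0 < x) :
    Real.Gamma x / Real.Gamma (x + α) ≤ (x + α) ^ (1 - α) / x := by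
  have hxα : 0 < x + α := by linarith
  have hG := Real.Gamma_pos_of_pos hxα
  have key : Real.Gamma (x + 1) ≤ Real.Gamma (x + α) * (x + α) ^ (1 - α) := by
    rcases hα₁.eq_or_lt with rfl | h1
    · simp
    have h := Real.Gamma_mul_add_mul_le_rpow_Gamma_mul_rpow_Gamma (s := x + α) (t := x + α + 1)
      (a := α) (b := 1 - α) hxα (by linarith) hα₀ (by linarith) (by ring)
    rw [Real.Gamma_add_one hxα.ne', Real.mul_rpow hxα.le hG.le] at h
    calc _ = Real.Gamma (α * (x + α) + (1 - α) * (x + α + 1)) := by congr 1; ring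
      _ ≤ _ := h
      _ = (x + α) ^ (1 - α) * (Real.Gamma (x + α) ^ α * Real.Gamma (x + α) ^ (1 - α)) := by ring
      _ = _ := by rw [← Real.rpow_add hG]; simp [mul_comm]
  rw [Real.Gamma_add_one hx.ne'] at key
  rw [div_le_div_iff₀ hG hx]
  linarith

theorem summable_mittagLeffler {α β : ℝ} (hα₀ : 0 < α) (hα₁ : α ≤ 1) (hβ : 0 < β) (x : ℝ) :
    Summable fun n : ℕ => x ^ n / Real.Gamma (α * n + β) := by
  rcases eq_or_ne x 0 with rfl | hx
  · refine summable_of_ne_finset_zero (s := {0}) fun n hn => ?_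
    simp at hn
    simp [hn]
  have hpos : ∀ n : ℕ, 0 < α * n + β := fun n => by positivity
  have hto : Tendsto (fun n : ℕ => α * (n : ℝ) + β) atTop atTop :=
    tendsto_atTop_add_const_right _ _ (tendsto_natCast_atTop_atTop.const_mul_atTop hα₀)
  refine summable_of_ratio_test_tendsto_lt_one (l := 0) zero_lt_one
    (Eventually.of_forall fun n => div_ne_zero (pow_ne_zero _ hx)
      (Real.Gamma_pos_of_pos (hpos n)).ne') ?_
  have hlim : Tendsto (fun y : ℝ => |x| * (2 * y ^ (-α))) atTop (𝓝 0) := by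
    simpa using ((tendsto_rpow_neg_atTop hα₀).const_mul 2).const_mul |x|
  refine squeeze_zero' (Eventually.of_forall fun n => by positivity) ?_ (hlim.comp hto)
  -- Once y ≥ α, y + α ≤ 2y, so the Gamma ratio is at most 2 y^(-α).
  filter_upwards [hto.eventually_ge_atTop α] with n hn
  set y := α * (n : ℝ) + β with hy
  have hy0 : 0 < y := hpos n
  have h1 : α * ((n + 1 : ℕ) : ℝ) + β = y + α := by push_cast; rw [hy]; ring
  have hG := Real.Gamma_pos_of_pos hy0
  have hG' : 0 < Real.Gamma (y + α) := Real.Gamma_pos_of_pos (by linarith)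
  rw [h1, norm_div, norm_div, norm_pow, norm_pow, Real.norm_of_nonneg hG.le,
    Real.norm_of_nonneg hG'.le, Real.norm_eq_abs]
  have h2 : |x| ^ (n + 1) / Real.Gamma (y + α) / (|x| ^ n / Real.Gamma y) =
      |x| * (Real.Gamma y / Real.Gamma (y + α)) := by
    have := abs_ne_zero.2 hx
    field_simp
    ring
  rw [h2]
  refine mul_le_mul_of_nonneg_left ((Gamma_div_Gamma_add_le hα₀ hα₁ hy0).trans ?_) (abs_nonneg _)
  calc (y + α) ^ (1 - α) / y ≤ (2 * y) ^ (1 - α) / y := by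
        gcongr; linarith
    _ ≤ 2 * y ^ (1 - α) / y := by
        rw [Real.mul_rpow (by norm_num) hy0.le]
        gcongr
        calc (2 : ℝ) ^ (1 - α) ≤ 2 ^ (1 : ℝ) :=
              Real.rpow_le_rpow_of_exponent_le (by norm_num) (by linarith)
          _ = 2 := by simp
    _ = 2 * y ^ (-α) := by
        rw [mul_div_assoc, sub_eq_add_neg, Real.rpow_add hy0, Real.rpow_one]
        field_simp

theorem continuous_mittagLeffler₂ {α β : ℝ} (hα₀ : 0 < α) (hα₁ : α ≤ 1) (hβ : 0 < β) :
    Continuous (mittagLeffler₂ α β) := by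
  rw [continuous_iff_continuousAt]
  intro x
  have hx : Metric.ball (0 : ℝ) (|x| + 1) ∈ 𝓝 x := Metric.isOpen_ball.mem_nhds (by simp)
  refine ContinuousOn.continuousAt (s := Metric.ball (0 : ℝ) (|x| + 1)) ?_ hx
  refine continuousOn_tsum (fun n => by fun_prop)
    (summable_mittagLeffler hα₀ hα₁ hβ (|x| + 1)) fun n y hy => ?_
  have hG : 0 < Real.Gamma (α * n + β) := Real.Gamma_pos_of_pos (by positivity)
  rw [norm_div, norm_pow, Real.norm_of_nonneg hG.le]
  have : ‖y‖ ≤ |x| + 1 := by simpa using (Metric.mem_ball.1 hy).le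
  gcongr

theorem mlKernel_term {α β A t : ℝ} (ht : 0 < t) (n : ℕ) :
    t ^ (β - 1) * ((-A * t ^ α) ^ n / Real.Gamma (α * n + β)) =
      (-A) ^ n * powKernel (α * n + β) t := by
  rw [powKernel, mul_pow, add_sub_assoc, Real.rpow_add ht, Real.rpow_mul ht.le, Real.rpow_natCast]
  ring

theorem hasSum_mlKernel {α β : ℝ} (hα₀ : 0 < α) (hα₁ : α ≤ 1) (hβ : 0 < β) (A : ℝ) {t : ℝ}
    (ht : 0 < t) :
    HasSum (fun n : ℕ => (-A) ^ n * powKernel (α * n + β) t) (mlKernel α β A t) := by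
  simp_rw [← mlKernel_term ht]
  exact (summable_mittagLeffler hα₀ hα₁ hβ _).hasSum.mul_left _

theorem continuousOn_mlKernel {α β : ℝ} (hα₀ : 0 < α) (hα₁ : α ≤ 1) (hβ : 0 < β) (A : ℝ) :
    ContinuousOn (mlKernel α β A) (Ioi 0) := by
  intro t ht
  refine ContinuousAt.continuousWithinAt ?_
  have h0 : t ≠ 0 := (mem_Ioi.1 ht).ne'
  refine (Real.continuousAt_rpow_const _ _ (Or.inl h0)).mul ?_
  exact (continuous_mittagLeffler₂ hα₀ hα₁ hβ).continuousAt.comp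
    (continuousAt_const.mul (Real.continuousAt_rpow_const _ _ (Or.inl h0)))

theorem intervalIntegrable_mlKernel {α β : ℝ} (hα₀ : 0 < α) (hα₁ : α ≤ 1) (hβ : 0 < β) (A t : ℝ) :
    IntervalIntegrable (mlKernel α β A) volume 0 t := by
  refine (intervalIntegrable_rpow' (by linarith)).mul_continuousOn
    (Continuous.continuousOn ?_)
  exact (continuous_mittagLeffler₂ hα₀ hα₁ hβ).comp
    (continuous_const.mul (Real.continuous_rpow_const hα₀.le))

/-- The kernel is a series of power kernels, so the semigroup law applies term by term. -/
theorem cconv_powKernel_mlKernel {α β γ : ℝ} (hα₀ : 0 < α) (hα₁ : α ≤ 1) (hβ : 0 < β)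
    (hγ : 0 < γ) (A : ℝ) {t : ℝ} (ht : 0 < t) :
    cconv (powKernel γ) (mlKernel α β A) t = mlKernel α (β + γ) A t := by
  have hpos : ∀ n : ℕ, 0 < α * n + β := fun n => by positivity
  let F : ℕ → ℝ → ℝ := fun n u => (-A) ^ n * (powKernel γ (t - u) * powKernel (α * n + β) u)
  have hint : ∀ n, IntervalIntegrable (F n) volume 0 t := fun n =>
    (intervalIntegrable_powKernel_mul_powKernel (hpos n) hγ ht).const_mul _
  have hval : ∀ n, ∫ u in (0 : ℝ)..t, F n u = (-A) ^ n * powKernel (α * n + (β + γ)) t := by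
    intro n
    simp only [F, intervalIntegral.integral_const_mul]
    rw [← add_assoc, ← cconv_powKernel (hpos n) hγ ht, cconv]
  have hnorm : ∀ n, ∫ u in Ioc 0 t, ‖F n u‖ = |A| ^ n * powKernel (α * n + (β + γ)) t := by
    intro n
    rw [← add_assoc, ← cconv_powKernel (hpos n) hγ ht, cconv,
      ← intervalIntegral.integral_const_mul, intervalIntegral.integral_of_le ht.le]
    refine setIntegral_congr_fun measurableSet_Ioc fun u hu => ?_
    have h1 := powKernel_nonneg hγ (sub_nonneg.2 hu.2)
    have h2 := powKernel_nonneg (hpos n) hu.1.le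
    simp only [F, norm_mul, norm_pow, norm_neg, Real.norm_of_nonneg h1, Real.norm_of_nonneg h2,
      Real.norm_eq_abs]
  have hsum := hasSum_integral_of_summable_integral_norm (μ := volume.restrict (Ioc 0 t)) (F := F)
    (fun n => (intervalIntegrable_iff_integrableOn_Ioc_of_le ht.le).1 (hint n)) (by
      simp_rw [hnorm]
      -- The series of norms is again a Mittag-Leffler series, with A replaced by -|A|.
      simpa using (hasSum_mlKernel hα₀ hα₁ (add_pos hβ hγ) (-|A|) ht).summable)
  simp_rw [← intervalIntegral.integral_of_le ht.le, hval] at hsum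
  rw [(hasSum_mlKernel hα₀ hα₁ (add_pos hβ hγ) A ht).unique hsum, cconv,
    intervalIntegral.integral_of_le ht.le, intervalIntegral.integral_of_le ht.le]
  refine setIntegral_congr_fun measurableSet_Ioc fun u hu => ?_
  simp only [F]
  rw [← (hasSum_mlKernel hα₀ hα₁ hβ A hu.1).tsum_eq, ← tsum_mul_left]
  congr 1
  ext n
  ring

/-- Splitting off the term n = 0 and shifting the index. This is the source of all the Volterra
equations below. -/
theorem mlKernel_eq_sub {α β : ℝ} (hα₀ : 0 < α) (hα₁ : α ≤ 1) (hβ : 0 < β) (A : ℝ) {t : ℝ}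
    (ht : 0 < t) :
    mlKernel α β A t = powKernel β t - A * mlKernel α (β + α) A t := by
  have h := hasSum_mlKernel hα₀ hα₁ hβ A ht
  have h' := (hasSum_nat_add_iff' 1).2 h
  have h2 := (hasSum_mlKernel hα₀ hα₁ (add_pos hβ hα₀) A ht).mul_left (-A)
  have h3 : (fun n : ℕ => (-A) * ((-A) ^ n * powKernel (α * n + (β + α)) t)) =
      fun n : ℕ => (-A) ^ (n + 1) * powKernel (α * (n + 1 : ℕ) + β) t := by
    ext n
    rw [show α * ((n + 1 : ℕ) : ℝ) + β = α * n + (β + α) by push_cast; ring]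
    ring
  rw [h3] at h2
  have := h'.unique h2
  simp at this
  linarith

theorem mittagLeffler₂_zero (α β : ℝ) : mittagLeffler₂ α β 0 = 1 / Real.Gamma β := by
  rw [mittagLeffler₂, tsum_eq_single 0 fun n hn => by simp [hn]]
  simp

theorem mlKernel_one (α A t : ℝ) : mlKernel α 1 A t = mittagLeffler α (-A * t ^ α) := by
  simp [mlKernel, mittagLeffler]

theorem mlKernel_one_zero {α : ℝ} (hα₀ : 0 < α) (A : ℝ) : mlKernel α 1 A 0 = 1 := by
  simp [mlKernel, Real.zero_rpow hα₀.ne', mittagLeffler₂_zero]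

theorem continuous_mlKernel_one {α : ℝ} (hα₀ : 0 < α) (hα₁ : α ≤ 1) (A : ℝ) :
    Continuous (mlKernel α 1 A) := by
  simp_rw [funext (mlKernel_one α A), mittagLeffler]
  exact (continuous_mittagLeffler₂ hα₀ hα₁ one_pos).comp
    (continuous_const.mul (Real.continuous_rpow_const hα₀.le))

/-! ### Associativity and continuity of causal convolution -/

theorem intervalIntegrable_comp_sub {f : ℝ → ℝ} {t : ℝ} (hf : IntervalIntegrable f volume 0 t) :
    IntervalIntegrable (fun u => f (t - u)) volume 0 t := by
  simpa using (hf.comp_sub_left t).symm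

theorem intervalIntegrable_cconv {f g : ℝ → ℝ} {t : ℝ} (ht : 0 ≤ t)
    (hf : IntervalIntegrable f volume 0 t) (hg : ContinuousOn g (Icc 0 t)) :
    IntervalIntegrable (fun u => f (t - u) * g u) volume 0 t :=
  (intervalIntegrable_comp_sub hf).mul_continuousOn (by rwa [uIcc_of_le ht])

theorem integral_eq_integral_indicator_Ioo (F : ℝ → ℝ) {a b : ℝ} (hab : a ≤ b) :
    ∫ u in a..b, F u = ∫ u, (Ioo a b).indicator F u := by
  rw [intervalIntegral.integral_of_le hab, integral_Ioc_eq_integral_Ioo,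
    MeasureTheory.integral_indicator measurableSet_Ioo]

theorem integrable_indicator_Ioo {f : ℝ → ℝ} {t : ℝ} (ht : 0 ≤ t)
    (hf : IntervalIntegrable f volume 0 t) : Integrable ((Ioo 0 t).indicator f) :=
  (integrable_indicator_iff measurableSet_Ioo).2
    (((intervalIntegrable_iff_integrableOn_Ioc_of_le ht).1 hf).mono_set Ioo_subset_Ioc_self)

/-- Fubini on the triangle 0 < v < u < t. Cutting all functions off outside (0, t) turns both sides
into integrals over the plane. As f and g may be singular at 0, integrability comes from the L¹
convolution integrand times the bounded factor h. -/
theorem cconv_assoc {f g h : ℝ → ℝ} {t : ℝ} (ht : 0 ≤ t)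
    (hf : IntervalIntegrable f volume 0 t) (hg : IntervalIntegrable g volume 0 t)
    (hh : ContinuousOn h (Icc 0 t)) :
    cconv f (cconv g h) t = cconv (cconv f g) h t := by
  set f0 := (Ioo 0 t).indicator f with hf0
  set g0 := (Ioo 0 t).indicator g with hg0
  set h0 := (Ioo 0 t).indicator h with hh0
  have If : Integrable f0 := integrable_indicator_Ioo ht hf
  have Ig : Integrable g0 := integrable_indicator_Ioo ht hg
  have Ih : Integrable h0 :=
    integrable_indicator_Ioo ht (ContinuousOn.intervalIntegrable (by rwa [uIcc_of_le ht]))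
  obtain ⟨C, hC⟩ : ∃ C, ∀ v, ‖h0 v‖ ≤ C := by
    obtain ⟨C, hC⟩ := isCompact_Icc.exists_bound_of_continuousOn hh
    refine ⟨max C 0, fun v => ?_⟩
    by_cases hv : v ∈ Ioo 0 t
    · simp only [hh0, indicator_of_mem hv]
      exact (hC v (Ioo_subset_Icc_self hv)).trans (le_max_left _ _)
    · simp [hh0, indicator_of_notMem hv]
  have hI : Integrable (fun p : ℝ × ℝ => h0 p.1 * (f0 (t - p.2) * g0 (p.2 - p.1)))
      (volume.prod volume) := by
    have h1 := Integrable.convolution_integrand (ContinuousLinearMap.mul ℝ ℝ)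
      (If.comp_sub_left t) (Ig.comp_neg)
    simp only [ContinuousLinearMap.mul_apply', neg_sub] at h1
    exact h1.bdd_mul (c := C) Ih.aestronglyMeasurable.comp_fst
      (Eventually.of_forall fun p => hC p.1)
  have hswap := integral_integral_swap (f := fun v u => h0 v * (f0 (t - u) * g0 (u - v))) hI
  have hL : cconv f (cconv g h) t = ∫ u, ∫ v, h0 v * (f0 (t - u) * g0 (u - v)) := by
    rw [cconv, integral_eq_integral_indicator_Ioo _ ht]
    congr 1
    ext u
    by_cases hu : u ∈ Ioo 0 t
    · rw [indicator_of_mem hu, cconv, integral_eq_integral_indicator_Ioo _ hu.1.le,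
        ← MeasureTheory.integral_const_mul]
      congr 1
      ext v
      have h1 : t - u ∈ Ioo 0 t := ⟨by linarith [hu.2], by linarith [hu.1]⟩
      simp only [hf0, indicator_of_mem h1]
      by_cases hv : v ∈ Ioo 0 u
      · have h2 : v ∈ Ioo 0 t := ⟨hv.1, hv.2.trans hu.2⟩
        have h3 : u - v ∈ Ioo 0 t := ⟨by linarith [hv.2], by linarith [hv.1, hu.2]⟩
        simp only [hg0, hh0, indicator_of_mem h2, indicator_of_mem h3, indicator_of_mem hv]
        ring
      · rw [indicator_of_notMem hv]
        by_cases h2 : v ∈ Ioo 0 t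
        · have h3 : u - v ∉ Ioo 0 t := fun h => hv ⟨h2.1, by linarith [h.1]⟩
          simp [hg0, indicator_of_notMem h3]
        · simp [hh0, indicator_of_notMem h2]
    · have h1 : t - u ∉ Ioo 0 t := fun h => hu ⟨by linarith [h.2], by linarith [h.1]⟩
      simp [hf0, indicator_of_notMem h1, indicator_of_notMem hu]
  have hR : cconv (cconv f g) h t = ∫ v, ∫ u, h0 v * (f0 (t - u) * g0 (u - v)) := by
    rw [cconv, integral_eq_integral_indicator_Ioo _ ht]
    congr 1
    ext v
    rw [MeasureTheory.integral_const_mul]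
    by_cases hv : v ∈ Ioo 0 t
    · simp only [hh0, indicator_of_mem hv]
      rw [mul_comm]
      congr 1
      have h4 : cconv f g (t - v) = ∫ u in v..t, f (t - u) * g (u - v) := by
        have := intervalIntegral.integral_comp_sub_right (a := v) (b := t)
          (fun u => f (t - v - u) * g u) v
        simp only [sub_self, sub_sub_sub_cancel_right] at this
        rw [cconv, ← this]
      rw [h4, integral_eq_integral_indicator_Ioo _ hv.2.le]
      congr 1
      ext u
      by_cases hu : u ∈ Ioo v t
      · have h1 : t - u ∈ Ioo 0 t := ⟨by linarith [hu.2], by linarith [hu.1, hv.1]⟩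
        have h3 : u - v ∈ Ioo 0 t := ⟨by linarith [hu.1], by linarith [hv.1, hu.2]⟩
        simp only [hf0, hg0, indicator_of_mem h1, indicator_of_mem h3, indicator_of_mem hu]
      · rw [indicator_of_notMem hu]
        by_cases h1 : t - u ∈ Ioo 0 t
        · have h3 : u - v ∉ Ioo 0 t := fun h => hu ⟨by linarith [h.1], by linarith [h1.1]⟩
          simp [hg0, indicator_of_notMem h3]
        · simp [hf0, indicator_of_notMem h1]
    · simp [hh0, indicator_of_notMem hv]
  rw [hL, hR, hswap]

theorem cconv_congr {f f' g g' : ℝ → ℝ} {t : ℝ} (ht : 0 ≤ t) (hf : ∀ u ∈ Ioo 0 t, f u = f' u)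
    (hg : ∀ u ∈ Ioo 0 t, g u = g' u) : cconv f g t = cconv f' g' t := by
  rw [cconv, cconv, integral_eq_integral_indicator_Ioo _ ht,
    integral_eq_integral_indicator_Ioo _ ht]
  congr 1
  refine indicator_congr fun u hu => ?_
  rw [hg u hu, hf (t - u) ⟨by linarith [hu.2], by linarith [hu.1]⟩]

/-- The substitution u = t v fixes both the interval and the singularity, so that dominated
convergence yields continuity in t. -/
theorem cconv_powKernel_eq {β t : ℝ} (hβ : 0 < β) (ht : 0 ≤ t) (g : ℝ → ℝ) :
    cconv (powKernel β) g t =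
      t ^ β * ∫ v in (0 : ℝ)..1, powKernel β (1 - v) * g (t * v) := by
  have h := intervalIntegral.mul_integral_comp_mul_left (a := 0) (b := 1)
    (f := fun u => powKernel β (t - u) * g u) t
  simp only [mul_zero, mul_one] at h
  rcases ht.eq_or_lt with rfl | h0
  · simp [cconv, Real.zero_rpow hβ.ne']
  rw [cconv, ← h, ← intervalIntegral.integral_const_mul, ← intervalIntegral.integral_const_mul]
  refine intervalIntegral.integral_congr fun v hv => ?_
  rw [uIcc_of_le zero_le_one] at hv
  simp only [powKernel]
  rw [show t - t * v = t * (1 - v) by ring, Real.mul_rpow ht (sub_nonneg.2 hv.2),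
    show t ^ β = t * t ^ (β - 1) by
      rw [← Real.rpow_one_add' ht (by simpa using hβ.ne')]; congr 1; ring]
  ring

theorem continuousOn_cconv_powKernel {β : ℝ} (hβ : 0 < β) {g : ℝ → ℝ}
    (hg : ContinuousOn g (Ici 0)) : ContinuousOn (cconv (powKernel β) g) (Ici 0) := by
  -- Extending g by g(0) to negative arguments allows dominated convergence around every real t₀,
  -- including 0.
  have hg' : Continuous fun x => g (max x 0) :=
    hg.comp_continuous (by fun_prop) fun x => mem_Ici.2 (le_max_right _ _)
  have hcont : Continuous fun t : ℝ =>
      ∫ v in (0 : ℝ)..1, powKernel β (1 - v) * g (max (t * v) 0) := by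
    rw [continuous_iff_continuousAt]
    intro t₀
    obtain ⟨C, hC⟩ := (isCompact_Icc (a := -(|t₀| + 1)) (b := |t₀| + 1)).exists_bound_of_continuousOn
      hg'.continuousOn
    have hk : IntervalIntegrable (fun v => powKernel β (1 - v)) volume 0 1 :=
      intervalIntegrable_comp_sub (intervalIntegrable_powKernel hβ 0 1)
    refine intervalIntegral.continuousAt_of_dominated_interval
      (bound := fun v => ‖powKernel β (1 - v)‖ * C) ?_ ?_ (hk.norm.mul_const _) ?_
    · refine Eventually.of_forall fun t => ?_
      exact (hk.mul_continuousOn (g := fun v => g (max (t * v) 0))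
        (hg'.comp (by fun_prop : Continuous fun v => t * v)).continuousOn).def'.aestronglyMeasurable
    · filter_upwards [Metric.ball_mem_nhds t₀ one_pos] with t ht
      refine Eventually.of_forall fun v hv => ?_
      rw [uIoc_of_le zero_le_one] at hv
      rw [norm_mul]
      refine mul_le_mul_of_nonneg_left (hC _ ?_) (norm_nonneg _)
      have h1 : |t * v| ≤ |t₀| + 1 := by
        rw [abs_mul, abs_of_pos hv.1]
        have : |t| ≤ |t₀| + 1 := by
          have h2 : |t - t₀| < 1 := by simpa [Real.dist_eq] using ht
          have := abs_sub_abs_le_abs_sub t t₀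
          linarith
        calc |t| * v ≤ |t| * 1 := mul_le_mul_of_nonneg_left hv.2 (abs_nonneg _)
          _ ≤ _ := by linarith
      exact abs_le.1 h1
    · refine Eventually.of_forall fun v _ => ?_
      exact (continuous_const.mul
        (hg'.comp (by fun_prop : Continuous fun t => t * v))).continuousAt
  refine ((Real.continuous_rpow_const hβ.le).mul hcont).continuousOn.congr fun t ht => ?_
  rw [cconv_powKernel_eq hβ ht]
  congr 1
  refine intervalIntegral.integral_congr fun v hv => ?_
  rw [uIcc_of_le zero_le_one] at hv
  rw [max_eq_left (mul_nonneg ht hv.1)]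

/-! ### Positivity of the resolvent kernel -/

theorem mlKernel_self_eq {α : ℝ} (hα₀ : 0 < α) (hα₁ : α ≤ 1) (A : ℝ) {t : ℝ} (ht : 0 < t) :
    mlKernel α α A t = powKernel α t - A * cconv (powKernel α) (mlKernel α α A) t := by
  rw [cconv_powKernel_mlKernel hα₀ hα₁ hα₀ hα₀ A ht, ← mlKernel_eq_sub hα₀ hα₁ hα₀ A ht]

theorem intervalIntegrable_powKernel_mul_mlKernel {α A t T : ℝ} (hα₀ : 0 < α) (hα₁ : α ≤ 1)
    (ht : 0 < t) (htT : t < T) :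
    IntervalIntegrable (fun u => powKernel α (T - u) * mlKernel α α A u) volume 0 t := by
  refine (intervalIntegrable_mlKernel hα₀ hα₁ hα₀ A t).continuousOn_mul ?_
  rw [uIcc_of_le ht.le]
  intro u hu
  have : T - u ≠ 0 := by linarith [hu.2]
  exact (((continuousAt_const.sub continuousAt_id).rpow_const (Or.inl this)).div_const
    _).continuousWithinAt

/-- The Volterra equation of the kernel `mlKernel α α A` is propagated forward, because
`powKernel α` is logarithmically convex. -/
theorem le_mlKernel_add {α A t T : ℝ} (hα₀ : 0 < α) (hα₁ : α ≤ 1) (hA : 0 ≤ A) (ht : 0 < t)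
    (htT : t < T) (hpos : ∀ u ∈ Ioo 0 T, 0 ≤ mlKernel α α A u) :
    (T / t) ^ (α - 1) * mlKernel α α A t -
        A * (∫ u in t..T, powKernel α (T - u) * mlKernel α α A u) ≤ mlKernel α α A T := by
  have hT := ht.trans htT
  have hG := Real.Gamma_pos_of_pos hα₀
  set ρ := (T / t) ^ (α - 1) with hρ
  have hkT : powKernel α T = ρ * powKernel α t := by
    rw [powKernel, powKernel, hρ, ← mul_div_assoc, ← Real.mul_rpow (by positivity) ht.le,
      div_mul_cancel₀ _ ht.ne']
  have hi1 := intervalIntegrable_powKernel_mul_mlKernel (A := A) hα₀ hα₁ ht htT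
  have hi2 : IntervalIntegrable (fun u => powKernel α (T - u) * mlKernel α α A u) volume t T := by
    refine (intervalIntegrable_comp_sub (intervalIntegrable_powKernel hα₀ 0 T)).mono_set
      (uIcc_subset_uIcc (by rw [uIcc_of_le hT.le]; exact ⟨ht.le, htT.le⟩) right_mem_uIcc)
      |>.mul_continuousOn ?_
    rw [uIcc_of_le htT.le]
    exact (continuousOn_mlKernel hα₀ hα₁ hα₀ A).mono fun u hu => ht.trans_le hu.1
  -- The integrand can be singular at both 0 and t; splitting at t/2 leaves one singularity in each
  -- half.
  have hi3 : IntervalIntegrable (fun u => powKernel α (t - u) * mlKernel α α A u) volume 0 t := by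
    by_contra hni
    have h0 : cconv (powKernel α) (mlKernel α α A) t = 0 := intervalIntegral.integral_undef hni
    have hs : t / 2 < t := by linarith
    have hb : IntervalIntegrable (fun u => powKernel α (t - u) * mlKernel α α A u)
        volume (t / 2) t := by
      refine (intervalIntegrable_comp_sub (intervalIntegrable_powKernel hα₀ 0 t)).mono_set
        (uIcc_subset_uIcc (by rw [uIcc_of_le ht.le]; constructor <;> linarith) right_mem_uIcc)
        |>.mul_continuousOn ?_
      rw [uIcc_of_le hs.le]
      exact (continuousOn_mlKernel hα₀ hα₁ hα₀ A).mono fun u hu => (half_pos ht).trans_le hu.1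
    exact hni ((intervalIntegrable_powKernel_mul_mlKernel hα₀ hα₁ (half_pos ht) hs).trans hb)
  have hle : (∫ u in (0 : ℝ)..t, powKernel α (T - u) * mlKernel α α A u) ≤
      ρ * cconv (powKernel α) (mlKernel α α A) t := by
    rw [cconv, ← intervalIntegral.integral_const_mul]
    refine intervalIntegral.integral_mono_on_of_le_Ioo ht.le hi1 (hi3.const_mul _) fun u hu => ?_
    have h1 : 0 < t - u := sub_pos.2 hu.2
    have h2 : 0 < T - u := by linarith
    -- For 0 < u < t, (T - u)/(t - u) ≥ T/t, and the exponent α - 1 is nonpositive.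
    have h3 : powKernel α (T - u) ≤ ρ * powKernel α (t - u) := by
      rw [powKernel, powKernel, hρ, ← mul_div_assoc, ← Real.mul_rpow (by positivity) h1.le]
      refine div_le_div_of_nonneg_right ?_ hG.le
      refine Real.rpow_le_rpow_of_nonpos (by positivity) ?_ (by linarith)
      rw [div_mul_eq_mul_div, div_le_iff₀ ht]
      nlinarith [hu.1]
    rw [← mul_assoc]
    exact mul_le_mul_of_nonneg_right h3 (hpos u ⟨hu.1, hu.2.trans htT⟩)
  have hsplit : cconv (powKernel α) (mlKernel α α A) T =
      (∫ u in (0 : ℝ)..t, powKernel α (T - u) * mlKernel α α A u) +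
        ∫ u in t..T, powKernel α (T - u) * mlKernel α α A u :=
    (intervalIntegral.integral_add_adjacent_intervals hi1 hi2).symm
  have e1 := mlKernel_self_eq hα₀ hα₁ A ht
  have e2 := mlKernel_self_eq hα₀ hα₁ A hT
  rw [e2, hsplit, hkT, e1]
  have := mul_le_mul_of_nonneg_left hle hA
  nlinarith

/-- Let T be the first zero of the continuous factor E. `le_mlKernel_add`, started at a point τ
shortly before T, carries at least half of r(τ) on to T, while the remaining integral costs strictly
less than half: hence r(T) > 0, a contradiction. -/
theorem mlKernel_pos {α A t : ℝ} (hα₀ : 0 < α) (hα₁ : α ≤ 1) (hA : 0 ≤ A) (ht : 0 < t) :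
    0 < mlKernel α α A t := by
  set E : ℝ → ℝ := fun t => mittagLeffler₂ α α (-A * t ^ α) with hE
  have hEc : Continuous E := (continuous_mittagLeffler₂ hα₀ hα₁ hα₀).comp
    (continuous_const.mul (Real.continuous_rpow_const hα₀.le))
  have hr : ∀ u, mlKernel α α A u = u ^ (α - 1) * E u := fun u => rfl
  have hE0 : 0 < E 0 := by
    simp only [hE, Real.zero_rpow hα₀.ne', mul_zero, mittagLeffler₂_zero]
    exact one_div_pos.2 (Real.Gamma_pos_of_pos hα₀)
  suffices h : 0 < E t by
    rw [hr]
    exact mul_pos (Real.rpow_pos_of_pos ht _) h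
  by_contra hneg
  have hcpt : IsCompact (Icc 0 t ∩ {u | E u ≤ 0}) :=
    isCompact_Icc.inter_right (isClosed_le hEc continuous_const)
  obtain ⟨T, ⟨⟨hT0, hTt⟩, hTE⟩, hmin⟩ :=
    hcpt.exists_isLeast ⟨t, ⟨ht.le, le_rfl⟩, not_lt.1 hneg⟩
  have hEpos : ∀ u, 0 ≤ u → u < T → 0 < E u := fun u h0 h1 => by
    by_contra h
    exact absurd (hmin ⟨⟨h0, h1.le.trans hTt⟩, not_lt.1 h⟩) (not_le.2 h1)
  have hT : 0 < T := hT0.lt_of_ne fun h => absurd hTE (by simpa [← h] using hE0)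
  have hlim : Tendsto (fun δ : ℝ => A * powKernel (α + 1) δ) (𝓝[>] 0) (𝓝 0) := by
    have : Continuous fun δ : ℝ => A * powKernel (α + 1) δ :=
      continuous_const.mul ((Real.continuous_rpow_const (by linarith)).div_const _)
    have h := this.tendsto 0
    simp only [powKernel, add_sub_cancel_right, Real.zero_rpow hα₀.ne', zero_div, mul_zero] at h
    simpa [powKernel] using h.mono_left nhdsWithin_le_nhds
  obtain ⟨δ, ⟨hδ1, hδ2⟩, hδ0⟩ := ((hlim.eventually_lt_const (by norm_num : (0 : ℝ) < 1 / 2)).and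
    (Ioc_mem_nhdsGT (half_pos hT))).and self_mem_nhdsWithin |>.exists
  have hδ0 : 0 < δ := hδ0
  -- Maximizing E rather than the kernel suffices: u^(α - 1) is nonincreasing, so r ≤ r(τ) on (τ,
  -- T).
  obtain ⟨τ, hτ, hmax⟩ := (isCompact_Icc (a := T - δ) (b := T)).exists_isMaxOn
    ⟨T, by constructor <;> linarith⟩ hEc.continuousOn
  have hτE : 0 < E τ := (hEpos (T - δ) (by linarith [hδ2.2]) (by linarith)).trans_le
    (hmax ⟨le_rfl, by linarith⟩)
  have hτT : τ < T := hτ.2.lt_of_ne fun h => absurd hTE (by simpa [← h] using hτE)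
  have hτ0 : 0 < τ := by linarith [hτ.1, hδ2.2]
  have hrτ : 0 < mlKernel α α A τ := by rw [hr]; exact mul_pos (Real.rpow_pos_of_pos hτ0 _) hτE
  have key := le_mlKernel_add hα₀ hα₁ hA hτ0 hτT fun u hu => by
    rw [hr]; exact mul_nonneg (Real.rpow_nonneg hu.1.le _) (hEpos u hu.1.le hu.2).le
  have hint : (∫ u in τ..T, powKernel α (T - u) * mlKernel α α A u) ≤
      powKernel (α + 1) δ * mlKernel α α A τ := by
    have hk : IntervalIntegrable (fun u => powKernel α (T - u)) volume τ T :=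
      (intervalIntegrable_comp_sub (intervalIntegrable_powKernel hα₀ 0 T)).mono_set
        (uIcc_subset_uIcc (by rw [uIcc_of_le hT.le]; exact ⟨hτ0.le, hτT.le⟩) right_mem_uIcc)
    have hcont : ContinuousOn (mlKernel α α A) (uIcc τ T) := by
      rw [uIcc_of_le hτT.le]
      exact (continuousOn_mlKernel hα₀ hα₁ hα₀ A).mono fun u hu => hτ0.trans_le hu.1
    calc _ ≤ ∫ u in τ..T, powKernel α (T - u) * mlKernel α α A τ := by
          refine intervalIntegral.integral_mono_on_of_le_Ioo hτT.le (hk.mul_continuousOn hcont)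
            (hk.mul_const _) fun u hu => ?_
          refine mul_le_mul_of_nonneg_left ?_ (powKernel_nonneg hα₀ (by linarith [hu.2]))
          rw [hr, hr]
          refine mul_le_mul ?_ (hmax ⟨hτ.1.trans hu.1.le, hu.2.le⟩)
            (hEpos u (hτ0.trans hu.1).le hu.2).le (Real.rpow_nonneg hτ0.le _)
          exact Real.rpow_le_rpow_of_nonpos hτ0 hu.1.le (by linarith)
      _ = powKernel (α + 1) (T - τ) * mlKernel α α A τ := by
          rw [intervalIntegral.integral_mul_const, intervalIntegral.integral_comp_sub_left, sub_self,
            integral_powKernel hα₀]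
      _ ≤ _ := by
          refine mul_le_mul_of_nonneg_right ?_ hrτ.le
          refine div_le_div_of_nonneg_right ?_ (Real.Gamma_pos_of_pos (by linarith)).le
          exact Real.rpow_le_rpow (by linarith) (by linarith [hτ.1]) (by linarith)
  have hρ : (1 / 2 : ℝ) ≤ (T / τ) ^ (α - 1) := by
    have h2 : T / τ ≤ 2 := by
      rw [div_le_iff₀ hτ0]; linarith [hτ.1, hδ2.2]
    calc (1 / 2 : ℝ) = 2 ^ (-1 : ℝ) := by rw [Real.rpow_neg_one]; norm_num
      _ ≤ 2 ^ (α - 1) := Real.rpow_le_rpow_of_exponent_le (by norm_num) (by linarith)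
      _ ≤ _ := Real.rpow_le_rpow_of_nonpos (by positivity) h2 (by linarith)
  have hrT : mlKernel α α A T ≤ 0 := by
    rw [hr]; exact mul_nonpos_of_nonneg_of_nonpos (Real.rpow_nonneg hT0 _) hTE
  have h1 := mul_le_mul_of_nonneg_left hint hA
  have h2 := mul_le_mul_of_nonneg_right hρ hrτ.le
  have h3 := mul_lt_mul_of_pos_right hδ1 hrτ
  linarith

/-! ### Monotonicity and supermultiplicativity of `E_α(-A t ^ α)` -/

theorem mlKernel_one_eq_integral {α A t : ℝ} (hα₀ : 0 < α) (hα₁ : α ≤ 1) (ht : 0 ≤ t) :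
    mlKernel α 1 A t = 1 - A * ∫ u in (0 : ℝ)..t, mlKernel α α A u := by
  rcases ht.eq_or_lt with rfl | ht
  · simp [mlKernel_one_zero hα₀]
  rw [mlKernel_eq_sub hα₀ hα₁ one_pos A ht, add_comm 1 α,
    ← cconv_powKernel_mlKernel hα₀ hα₁ hα₀ one_pos A ht, powKernel_one]
  simp [cconv, powKernel_one]

theorem mlKernel_one_eq_cconv {α A t : ℝ} (hα₀ : 0 < α) (hα₁ : α ≤ 1) (ht : 0 ≤ t) :
    mlKernel α 1 A t = 1 - A * cconv (powKernel α) (mlKernel α 1 A) t := by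
  rcases ht.eq_or_lt with rfl | ht
  · simp [mlKernel_one_zero hα₀, cconv]
  rw [cconv_powKernel_mlKernel hα₀ hα₁ one_pos hα₀ A ht, mlKernel_eq_sub hα₀ hα₁ one_pos A ht,
    powKernel_one]

theorem mlKernel_one_sub {α A t t' : ℝ} (hα₀ : 0 < α) (hα₁ : α ≤ 1) (ht : 0 ≤ t) (htt : t ≤ t') :
    mlKernel α 1 A t - mlKernel α 1 A t' = A * ∫ u in t..t', mlKernel α α A u := by
  rw [mlKernel_one_eq_integral hα₀ hα₁ ht, mlKernel_one_eq_integral hα₀ hα₁ (ht.trans htt),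
    ← intervalIntegral.integral_interval_sub_left (intervalIntegrable_mlKernel hα₀ hα₁ hα₀ A t')
      (intervalIntegrable_mlKernel hα₀ hα₁ hα₀ A t)]
  ring

theorem mlKernel_one_antitoneOn {α A : ℝ} (hα₀ : 0 < α) (hα₁ : α ≤ 1) (hA : 0 ≤ A) :
    AntitoneOn (mlKernel α 1 A) (Ici 0) := by
  intro t ht t' _ htt
  rw [← sub_nonneg, mlKernel_one_sub hα₀ hα₁ ht htt]
  refine mul_nonneg hA (intervalIntegral.integral_nonneg htt fun u hu => ?_)
  -- At u = 0 the factor 0^(α - 1) takes its conventional value, which is nonnegative.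
  rcases (ht.trans hu.1 : (0 : ℝ) ≤ u).eq_or_lt with rfl | h
  · exact mul_nonneg (Real.rpow_nonneg le_rfl _) (by
      simpa [Real.zero_rpow hα₀.ne', mittagLeffler₂_zero] using
        (Real.Gamma_pos_of_pos hα₀).le)
  · exact (mlKernel_pos hα₀ hα₁ hA h).le

theorem mlKernel_one_le_one {α A t : ℝ} (hα₀ : 0 < α) (hα₁ : α ≤ 1) (hA : 0 ≤ A) (ht : 0 ≤ t) :
    mlKernel α 1 A t ≤ 1 :=
  (mlKernel_one_antitoneOn hα₀ hα₁ hA self_mem_Ici ht ht).trans_eq (mlKernel_one_zero hα₀ A)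

theorem cconv_powKernel_one_sub_mlKernel {α A t : ℝ} (hα₀ : 0 < α) (hα₁ : α < 1) (ht : 0 < t) :
    cconv (powKernel (1 - α)) (mlKernel α α A) t = mlKernel α 1 A t := by
  rw [cconv_powKernel_mlKernel hα₀ hα₁.le hα₀ (sub_pos.2 hα₁) A ht, add_sub_cancel]

theorem mlKernel_one_nonneg {α A t : ℝ} (hα₀ : 0 < α) (hα₁ : α ≤ 1) (hA : 0 ≤ A) (ht : 0 ≤ t) :
    0 ≤ mlKernel α 1 A t := by
  rcases ht.eq_or_lt with rfl | ht
  · simp [mlKernel_one_zero hα₀]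
  rcases hα₁.eq_or_lt with rfl | h1
  · exact (mlKernel_pos hα₀ le_rfl hA ht).le
  rw [← cconv_powKernel_one_sub_mlKernel hα₀ h1 ht, cconv, intervalIntegral.integral_of_le ht.le,
    integral_Ioc_eq_integral_Ioo]
  exact setIntegral_nonneg measurableSet_Ioo fun u hu =>
    mul_nonneg (powKernel_nonneg (by linarith) (by linarith [hu.2]))
      (mlKernel_pos hα₀ hα₁ hA hu.1).le

/-- For A > 0 there is a strict decrease from t to t + 1, and the value at t + 1 is nonnegative. -/
theorem mlKernel_one_pos {α A t : ℝ} (hα₀ : 0 < α) (hα₁ : α ≤ 1) (hA : 0 ≤ A) (ht : 0 ≤ t) :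
    0 < mlKernel α 1 A t := by
  rcases hA.eq_or_lt with rfl | hA'
  · simp [mlKernel_one_eq_integral hα₀ hα₁ ht]
  have h := mlKernel_one_sub (A := A) hα₀ hα₁ ht (le_add_of_nonneg_right zero_le_one : t ≤ t + 1)
  have h1 := mlKernel_one_nonneg hα₀ hα₁ hA (by linarith : 0 ≤ t + 1)
  have h2 : 0 < ∫ u in t..t + 1, mlKernel α α A u := by
    refine intervalIntegral.intervalIntegral_pos_of_pos_on ?_
      (fun u hu => mlKernel_pos hα₀ hα₁ hA (ht.trans_lt hu.1)) (by linarith)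
    exact (intervalIntegrable_mlKernel hα₀ hα₁ hα₀ A t).symm.trans
      (intervalIntegrable_mlKernel hα₀ hα₁ hα₀ A (t + 1))
  linarith [mul_pos hA' h2]

theorem one_sub_le_mlKernel_one {α A t : ℝ} (hα₀ : 0 < α) (hα₁ : α ≤ 1) (hA : 0 ≤ A)
    (ht : 0 ≤ t) : 1 - A * powKernel (α + 1) t ≤ mlKernel α 1 A t := by
  have hk := intervalIntegrable_comp_sub (intervalIntegrable_powKernel hα₀ 0 t)
  have : cconv (powKernel α) (mlKernel α 1 A) t ≤ powKernel (α + 1) t := by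
    calc _ ≤ ∫ u in (0 : ℝ)..t, powKernel α (t - u) := by
          refine intervalIntegral.integral_mono_on ht
            (hk.mul_continuousOn (continuous_mlKernel_one hα₀ hα₁ A).continuousOn) hk
            fun u hu => ?_
          exact mul_le_of_le_one_right (powKernel_nonneg hα₀ (by linarith [hu.2]))
            (mlKernel_one_le_one hα₀ hα₁ hA hu.1)
      _ = _ := by
          rw [intervalIntegral.integral_comp_sub_left, sub_self, sub_zero, integral_powKernel hα₀]
  rw [mlKernel_one_eq_cconv hα₀ hα₁ ht]
  linarith [mul_le_mul_of_nonneg_left this hA]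

/-- The resolvent formula of the Volterra equation `y + A (k_α * y) = f`. -/
theorem eq_sub_cconv_mlKernel {α A t : ℝ} (hα₀ : 0 < α) (hα₁ : α ≤ 1) (ht : 0 ≤ t) {y f : ℝ → ℝ}
    (hy : ContinuousOn y (Ici 0))
    (hf : ∀ u, 0 ≤ u → f u = y u + A * cconv (powKernel α) y u) :
    y t = f t - A * cconv (mlKernel α α A) f t := by
  have hr := intervalIntegrable_mlKernel hα₀ hα₁ hα₀ A t
  have hk := intervalIntegrable_powKernel hα₀ 0 t
  have hyt : ContinuousOn y (Icc 0 t) := hy.mono Icc_subset_Ici_self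
  have hct : ContinuousOn (cconv (powKernel α) y) (Icc 0 t) :=
    (continuousOn_cconv_powKernel hα₀ hy).mono Icc_subset_Ici_self
  have h1 : cconv (mlKernel α α A) f t = cconv (mlKernel α α A) y t +
      A * cconv (cconv (mlKernel α α A) (powKernel α)) y t := by
    rw [← cconv_assoc ht hr hk hyt, cconv, cconv, cconv, ← intervalIntegral.integral_const_mul,
      ← intervalIntegral.integral_add (intervalIntegrable_cconv ht hr hyt)
        ((intervalIntegrable_cconv ht hr hct).const_mul A)]
    refine intervalIntegral.integral_congr fun u hu => ?_
    rw [uIcc_of_le ht] at hu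
    simp only [hf u hu.1]
    ring
  have h2 : A * cconv (cconv (mlKernel α α A) (powKernel α)) y t =
      cconv (powKernel α) y t - cconv (mlKernel α α A) y t := by
    have : cconv (fun u => A * cconv (mlKernel α α A) (powKernel α) u) y t =
        cconv (fun u => powKernel α u - mlKernel α α A u) y t :=
      cconv_congr ht (fun u hu => by
        rw [cconv_comm, mlKernel_self_eq hα₀ hα₁ A hu.1]; ring) fun _ _ => rfl
    rw [cconv, cconv, cconv, ← intervalIntegral.integral_const_mul,
      ← intervalIntegral.integral_sub (intervalIntegrable_cconv ht hk hyt)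
        (intervalIntegrable_cconv ht hr hyt)]
    simp only [cconv] at this ⊢
    simp only [← mul_assoc, ← sub_mul]
    exact this
  rw [hf t ht, h1, h2]
  ring

/-- The translate y(t) = s(t + τ) solves y + A k_α * y = f, where f carries the memory of [0, τ].
Since k_α is nonincreasing, f is nondecreasing, with f(0) = s(τ). The resolvent formula and r > 0
give y(t) ≥ f(t)(1 - A ∫₀ᵗ r) = f(t) s(t) ≥ s(τ) s(t). -/
theorem mlKernel_one_mul_le {α A τ t : ℝ} (hα₀ : 0 < α) (hα₁ : α ≤ 1) (hA : 0 ≤ A) (hτ : 0 ≤ τ)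
    (ht : 0 ≤ t) : mlKernel α 1 A τ * mlKernel α 1 A t ≤ mlKernel α 1 A (t + τ) := by
  set s := mlKernel α 1 A with hs
  have hsc : Continuous s := continuous_mlKernel_one hα₀ hα₁ A
  set f : ℝ → ℝ := fun t => 1 - A * ∫ u in (0 : ℝ)..τ, powKernel α (t + τ - u) * s u with hf
  have hk : ∀ t, 0 ≤ t → IntervalIntegrable (fun u => powKernel α (t + τ - u) * s u)
      volume 0 (t + τ) := fun t ht =>
    intervalIntegrable_cconv (by linarith) (intervalIntegrable_powKernel hα₀ _ _)
      hsc.continuousOn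
  have hk1 : ∀ t, 0 ≤ t → IntervalIntegrable (fun u => powKernel α (t + τ - u) * s u)
      volume 0 τ := fun t ht => (hk t ht).mono_set
    (uIcc_subset_uIcc left_mem_uIcc (by rw [uIcc_of_le (by linarith)]; constructor <;> linarith))
  have hk2 : ∀ t, 0 ≤ t → IntervalIntegrable (fun u => powKernel α (t + τ - u) * s u)
      volume τ (t + τ) := fun t ht => (hk t ht).mono_set
    (uIcc_subset_uIcc (by rw [uIcc_of_le (by linarith)]; constructor <;> linarith) right_mem_uIcc)
  have hfy : ∀ u, 0 ≤ u → f u = s (u + τ) + A * cconv (powKernel α) (fun v => s (v + τ)) u := by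
    intro u hu
    have h1 := intervalIntegral.integral_comp_add_right (a := 0) (b := u)
      (fun v => powKernel α (u + τ - v) * s v) τ
    simp only [zero_add, add_sub_add_right_eq_sub] at h1
    rw [hs, mlKernel_one_eq_cconv hα₀ hα₁ (by linarith), ← hs, cconv, cconv, h1,
      ← intervalIntegral.integral_add_adjacent_intervals (hk1 u hu) (hk2 u hu)]
    simp only [hf]
    ring
  have hmono : MonotoneOn f (Ici 0) := by
    intro u hu v hv huv
    refine sub_le_sub_left (mul_le_mul_of_nonneg_left ?_ hA) _
    refine intervalIntegral.integral_mono_on_of_le_Ioo hτ (hk1 v hv) (hk1 u hu) fun x hx => ?_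
    refine mul_le_mul_of_nonneg_right ?_ (mlKernel_one_nonneg hα₀ hα₁ hA hx.1.le)
    refine div_le_div_of_nonneg_right ?_ (Real.Gamma_pos_of_pos hα₀).le
    exact Real.rpow_le_rpow_of_nonpos (by linarith [hx.2, mem_Ici.1 hu]) (by linarith)
      (by linarith)
  have hf0 : f 0 = s τ := by
    simp [hfy 0 le_rfl, cconv]
  have hsol := eq_sub_cconv_mlKernel (A := A) (f := f) hα₀ hα₁ ht
    (hsc.comp (continuous_id.add continuous_const : Continuous fun v => v + τ)).continuousOn hfy
  have hr := intervalIntegrable_comp_sub (intervalIntegrable_mlKernel hα₀ hα₁ hα₀ A t)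
  have hfc : ContinuousOn f (uIcc 0 t) := by
    have : ContinuousOn (fun u => s (u + τ) + A * cconv (powKernel α) (fun v => s (v + τ)) u)
        (Ici 0) := by
      refine ContinuousOn.add (by fun_prop) (continuousOn_const.mul
        (continuousOn_cconv_powKernel hα₀ (by fun_prop)))
    rw [uIcc_of_le ht]
    exact (this.congr hfy).mono Icc_subset_Ici_self
  have hle : cconv (mlKernel α α A) f t ≤ (∫ u in (0 : ℝ)..t, mlKernel α α A u) * f t := by
    calc _ ≤ ∫ u in (0 : ℝ)..t, mlKernel α α A (t - u) * f t := by
          refine intervalIntegral.integral_mono_on_of_le_Ioo ht (hr.mul_continuousOn hfc)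
            (hr.mul_const _) fun u hu => ?_
          exact mul_le_mul_of_nonneg_left (hmono hu.1.le ht hu.2.le)
            (mlKernel_pos hα₀ hα₁ hA (sub_pos.2 hu.2)).le
      _ = _ := by
          rw [intervalIntegral.integral_mul_const, intervalIntegral.integral_comp_sub_left, sub_self,
            sub_zero]
  have hst := mlKernel_one_eq_integral (A := A) hα₀ hα₁ ht
  have h0t : s τ ≤ f t := hf0 ▸ hmono self_mem_Ici ht ht
  have hsn : 0 ≤ s t := mlKernel_one_nonneg hα₀ hα₁ hA ht
  calc s τ * s t ≤ f t * s t := mul_le_mul_of_nonneg_right h0t hsn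
    _ = f t - A * ((∫ u in (0 : ℝ)..t, mlKernel α α A u) * f t) := by rw [hs, hst]; ring
    _ ≤ f t - A * cconv (mlKernel α α A) f t := by
        linarith [mul_le_mul_of_nonneg_left hle hA]
    _ = _ := hsol.symm

/-! ### Fractional integrals and the relaxation equation -/

theorem rlIntegral_zero (x : ℝ → ℝ) : rlIntegral 0 x = x := by
  ext t
  simp [rlIntegral]

theorem rlIntegral_eq_cconv {β : ℝ} (hβ : β ≠ 0) (x : ℝ → ℝ) :
    rlIntegral β x = cconv (powKernel β) x := by
  ext t
  rw [rlIntegral, if_neg hβ, cconv, ← intervalIntegral.integral_const_mul]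
  congr 1
  ext u
  rw [powKernel]
  ring

theorem continuousOn_rlIntegral {β : ℝ} (hβ : 0 ≤ β) {x : ℝ → ℝ} (hx : ContinuousOn x (Ici 0)) :
    ContinuousOn (rlIntegral β x) (Ici 0) := by
  rcases hβ.eq_or_lt with rfl | hβ
  · rwa [rlIntegral_zero]
  · rw [rlIntegral_eq_cconv hβ.ne']
    exact continuousOn_cconv_powKernel hβ hx

theorem rlIntegral_sub_const_mul {β t : ℝ} (hβ : 0 ≤ β) (ht : 0 ≤ t) {x y : ℝ → ℝ}
    (hx : ContinuousOn x (Ici 0)) (hy : ContinuousOn y (Ici 0)) (c : ℝ) :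
    rlIntegral β (fun u => x u - c * y u) t = rlIntegral β x t - c * rlIntegral β y t := by
  rcases hβ.eq_or_lt with rfl | hβ
  · simp only [rlIntegral_zero]
  simp only [rlIntegral_eq_cconv hβ.ne', cconv]
  have hk := intervalIntegrable_powKernel hβ 0 t
  rw [← intervalIntegral.integral_const_mul, ← intervalIntegral.integral_sub
    (intervalIntegrable_cconv ht hk (hx.mono Icc_subset_Ici_self))
    ((intervalIntegrable_cconv ht hk (hy.mono Icc_subset_Ici_self)).const_mul c)]
  congr 1
  ext u
  ring

theorem rlIntegral_apply_zero {β : ℝ} {x : ℝ → ℝ} (hx : x 0 = 0) : rlIntegral β x 0 = 0 := by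
  simp [rlIntegral, hx]

/-- The Mittag-Leffler function `t ↦ E_α(-A t ^ α)` solves the integrated relaxation equation. -/
theorem rlIntegral_mlKernel_one_sub_one {α A t : ℝ} (hα₀ : 0 < α) (hα₁ : α ≤ 1) (ht : 0 ≤ t) :
    rlIntegral (1 - α) (fun u => mlKernel α 1 A u - 1) t =
      -A * ∫ u in (0 : ℝ)..t, mlKernel α 1 A u := by
  rcases ht.eq_or_lt with rfl | h0
  · rw [rlIntegral_apply_zero (by simp [mlKernel_one_zero hα₀])]
    simp
  rcases hα₁.eq_or_lt with rfl | h1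
  · rw [sub_self, rlIntegral_zero, mlKernel_one_eq_integral hα₀ hα₁ ht]
    ring
  have hβ : 0 < 1 - α := sub_pos.2 h1
  have hlin := rlIntegral_sub_const_mul hβ.le ht
    (continuous_mlKernel_one hα₀ hα₁ A).continuousOn (continuousOn_const (c := (1 : ℝ))) 1
  simp only [mul_one] at hlin
  have hone : cconv (powKernel (1 - α)) (fun _ => 1) t = powKernel (1 + (1 - α)) t := by
    rw [← cconv_powKernel one_pos hβ h0]
    simp only [cconv, powKernel_one]
  have h2 : ∫ u in (0 : ℝ)..t, mlKernel α 1 A u = mlKernel α (1 + (1 - α) + α) A t := by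
    rw [show 1 + (1 - α) + α = 1 + 1 by ring,
      ← cconv_powKernel_mlKernel hα₀ hα₁ one_pos one_pos A h0]
    simp [cconv, powKernel_one]
  rw [hlin, rlIntegral_eq_cconv hβ.ne', rlIntegral_eq_cconv hβ.ne', hone,
    cconv_powKernel_mlKernel hα₀ hα₁ one_pos hβ A h0, h2,
    mlKernel_eq_sub hα₀ hα₁ (by linarith : 0 < 1 + (1 - α)) A h0]
  ring

theorem cconv_mlKernel_rlIntegral {α A t : ℝ} (hα₀ : 0 < α) (hα₁ : α ≤ 1) (ht : 0 ≤ t)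
    {y : ℝ → ℝ} (hy : ContinuousOn y (Ici 0)) :
    cconv (mlKernel α α A) (rlIntegral (1 - α) y) t = cconv (mlKernel α 1 A) y t := by
  rcases hα₁.eq_or_lt with rfl | h1
  · rw [sub_self, rlIntegral_zero]
  have hβ : 0 < 1 - α := sub_pos.2 h1
  rw [rlIntegral_eq_cconv hβ.ne', cconv_assoc ht (intervalIntegrable_mlKernel hα₀ hα₁ hα₀ A t)
    (intervalIntegrable_powKernel hβ 0 t) (hy.mono Icc_subset_Ici_self)]
  refine cconv_congr ht (fun u hu => ?_) fun _ _ => rfl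
  rw [cconv_comm, cconv_powKernel_one_sub_mlKernel hα₀ h1 hu.1]

/-- Convolution with `mlKernel α α A` inverts the integrated relaxation operator. -/
theorem cconv_mlKernel_relaxation {α A t : ℝ} (hα₀ : 0 < α) (hα₁ : α ≤ 1) (ht : 0 ≤ t)
    {y : ℝ → ℝ} (hy : ContinuousOn y (Ici 0)) :
    cconv (mlKernel α α A)
      (fun v => A * cconv (powKernel 1) y v + rlIntegral (1 - α) y v) t =
      ∫ u in (0 : ℝ)..t, y u := by
  have hr := intervalIntegrable_mlKernel hα₀ hα₁ hα₀ A t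
  have hyt : ContinuousOn y (Icc 0 t) := hy.mono Icc_subset_Ici_self
  have i1 := intervalIntegrable_cconv ht hr
    ((continuousOn_cconv_powKernel one_pos hy).mono Icc_subset_Ici_self)
  have i2 := intervalIntegrable_cconv ht hr
    ((continuousOn_rlIntegral (sub_nonneg.2 hα₁) hy).mono Icc_subset_Ici_self)
  have hsplit : cconv (mlKernel α α A)
      (fun v => A * cconv (powKernel 1) y v + rlIntegral (1 - α) y v) t =
      A * cconv (mlKernel α α A) (cconv (powKernel 1) y) t +
        cconv (mlKernel α α A) (rlIntegral (1 - α) y) t := by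
    rw [cconv, cconv, cconv, ← intervalIntegral.integral_const_mul,
      ← intervalIntegral.integral_add (i1.const_mul A) i2]
    congr 1
    ext u
    ring
  have hs : IntervalIntegrable (fun u => mlKernel α 1 A (t - u) * y u) volume 0 t :=
    intervalIntegrable_cconv ht ((continuous_mlKernel_one hα₀ hα₁ A).intervalIntegrable 0 t) hyt
  have hyi : IntervalIntegrable y volume 0 t :=
    ContinuousOn.intervalIntegrable (by rwa [uIcc_of_le ht])
  rw [hsplit, cconv_mlKernel_rlIntegral hα₀ hα₁ ht hy,
    cconv_assoc ht hr (intervalIntegrable_powKernel one_pos 0 t) hyt]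
  have h1 : cconv (cconv (mlKernel α α A) (powKernel 1)) y t =
      ∫ u in (0 : ℝ)..t, (∫ x in (0 : ℝ)..(t - u), mlKernel α α A x) * y u := by
    rw [cconv]
    congr 1
    ext u
    rw [cconv_comm, cconv]
    simp [powKernel_one]
  have h2 : A * cconv (cconv (mlKernel α α A) (powKernel 1)) y t =
      -- A r * 1 = 1 - s, while r * k_{1-α} = s (or r = s if α = 1); the two s * y terms cancel.
      ∫ u in (0 : ℝ)..t, (y u - mlKernel α 1 A (t - u) * y u) := by
    rw [h1, ← intervalIntegral.integral_const_mul]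
    refine intervalIntegral.integral_congr fun u hu => ?_
    rw [uIcc_of_le ht] at hu
    rw [mlKernel_one_eq_integral hα₀ hα₁ (sub_nonneg.2 hu.2)]
    ring
  rw [h2, intervalIntegral.integral_sub hyi hs, cconv]
  ring

/-! ### The comparison principle -/

/-- With the time shift placed on H, the integrand over [0, t] decreases because H does, and the new
piece over [t, t'] is nonpositive because H ≤ H(0) = 0. -/
theorem cconv_mlKernel_antitone {α A T : ℝ} (hα₀ : 0 < α) (hα₁ : α ≤ 1) (hA : 0 ≤ A)
    {H : ℝ → ℝ} (hHc : ContinuousOn H (Icc 0 T)) (hH : AntitoneOn H (Icc 0 T)) (hH0 : H 0 = 0)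
    {t t' : ℝ} (ht : 0 ≤ t) (htt : t ≤ t') (htT : t' ≤ T) :
    cconv (mlKernel α α A) H t' ≤ cconv (mlKernel α α A) H t := by
  have ht' := ht.trans htt
  have hi : ∀ v, 0 ≤ v → v ≤ t' →
      IntervalIntegrable (fun u => H (v - u) * mlKernel α α A u) volume 0 v := by
    intro v hv hvt
    refine (intervalIntegrable_mlKernel hα₀ hα₁ hα₀ A v).continuousOn_mul ?_
    rw [uIcc_of_le hv]
    exact hHc.comp (by fun_prop) fun u hu => ⟨by linarith [hu.2], by linarith [hu.1]⟩
  have hi' := hi t' ht' le_rfl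
  have hi1 := hi'.mono_set (uIcc_subset_uIcc left_mem_uIcc
    (by rw [uIcc_of_le ht']; exact ⟨ht, htt⟩) : uIcc 0 t ⊆ uIcc 0 t')
  have hi2 := hi'.mono_set (uIcc_subset_uIcc
    (by rw [uIcc_of_le ht']; exact ⟨ht, htt⟩) right_mem_uIcc : uIcc t t' ⊆ uIcc 0 t')
  rw [cconv_comm, cconv_comm _ H t, cconv, cconv,
    ← intervalIntegral.integral_add_adjacent_intervals hi1 hi2]
  have h1 : (∫ u in (0 : ℝ)..t, H (t' - u) * mlKernel α α A u) ≤
      ∫ u in (0 : ℝ)..t, H (t - u) * mlKernel α α A u := by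
    refine intervalIntegral.integral_mono_on_of_le_Ioo ht hi1 (hi t ht htt) fun u hu => ?_
    refine mul_le_mul_of_nonneg_right ?_ (mlKernel_pos hα₀ hα₁ hA hu.1).le
    exact hH ⟨by linarith [hu.2], by linarith [hu.1]⟩ ⟨by linarith [hu.2], by linarith [hu.1]⟩
      (by linarith)
  have h2 : (∫ u in t..t', H (t' - u) * mlKernel α α A u) ≤ ∫ u in t..t', (0 : ℝ) := by
    refine intervalIntegral.integral_mono_on_of_le_Ioo htt hi2 intervalIntegrable_const
      fun u hu => ?_
    refine mul_nonpos_of_nonpos_of_nonneg ?_ (mlKernel_pos hα₀ hα₁ hA (ht.trans_lt hu.1)).le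
    rw [← hH0]
    exact hH ⟨le_rfl, ht'.trans htT⟩ ⟨by linarith [hu.2], by linarith [hu.1]⟩ (by linarith [hu.2])
  rw [intervalIntegral.integral_zero] at h2
  linarith

theorem hasDerivAt_cconv_one {x : ℝ → ℝ} (hx : ContinuousOn x (Ici 0)) {t : ℝ} (ht : 0 < t) :
    HasDerivAt (cconv (powKernel 1) x) (x t) t := by
  have : cconv (powKernel 1) x = fun v => ∫ u in (0 : ℝ)..v, x u := by
    ext v
    simp [cconv, powKernel_one]
  rw [this]
  refine intervalIntegral.integral_hasDerivAt_right ?_ ?_ (hx.continuousAt (Ici_mem_nhds ht))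
  · refine ContinuousOn.intervalIntegrable (hx.mono ?_)
    rw [uIcc_of_le ht.le]
    exact Icc_subset_Ici_self
  · exact (hx.mono Ioi_subset_Ici_self).stronglyMeasurableAtFilter isOpen_Ioi t ht

/-- Comparison principle: a subsolution of the fractional relaxation equation lies below the
solution with the same initial value. -/
theorem le_mul_mlKernel_one_of_caputoDeriv_le {α A T : ℝ} (hα₀ : 0 < α) (hα₁ : α ≤ 1)
    (hA : 0 ≤ A) (hT : 0 < T) {m : ℝ → ℝ} (hm : ContinuousOn m (Ici 0))
    (hd : ∀ t ∈ Ioo 0 T, CaputoDifferentiableAt α m t)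
    (hle : ∀ t ∈ Ioo 0 T, caputoDeriv α m t ≤ -A * m t) :
    m T ≤ m 0 * mlKernel α 1 A T := by
  have hs := continuous_mlKernel_one hα₀ hα₁ A
  have hβ := sub_nonneg.2 hα₁
  set y : ℝ → ℝ := fun u => m u - m 0 * mlKernel α 1 A u with hy
  have hyc : ContinuousOn y (Ici 0) := hm.sub (continuousOn_const.mul hs.continuousOn)
  have hy0 : y 0 = 0 := by simp [hy, mlKernel_one_zero hα₀]
  -- Only H needs a derivative, not y: H' = A m + D^α m ≤ 0, the contributions of m(0) s cancelling.
  -- Then r * H = ∫₀ᵗ y is nonincreasing, which forces y(T) ≤ 0 by continuity.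
  set H : ℝ → ℝ := fun v => A * cconv (powKernel 1) y v + rlIntegral (1 - α) y v with hH
  have hHc : ContinuousOn H (Ici 0) :=
    (continuousOn_const.mul (continuousOn_cconv_powKernel one_pos hyc)).add
      (continuousOn_rlIntegral hβ hyc)
  have hHeq : ∀ t, 0 ≤ t → H t = A * cconv (powKernel 1) m t +
      rlIntegral (1 - α) (fun u => m u - m 0) t := by
    intro t ht
    have e1 : rlIntegral (1 - α) y t = rlIntegral (1 - α) (fun u => m u - m 0) t -
        m 0 * rlIntegral (1 - α) (fun u => mlKernel α 1 A u - 1) t := by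
      rw [← rlIntegral_sub_const_mul (x := fun u => m u - m 0)
        (y := fun u => mlKernel α 1 A u - 1) hβ ht (hm.sub continuousOn_const)
        (hs.continuousOn.sub continuousOn_const)]
      congr 1
      ext u
      simp only [hy]
      ring
    have e2 : cconv (powKernel 1) y t = cconv (powKernel 1) m t -
        m 0 * ∫ u in (0 : ℝ)..t, mlKernel α 1 A u := by
      have := rlIntegral_sub_const_mul zero_le_one ht hm hs.continuousOn (m 0)
      rw [rlIntegral_eq_cconv one_ne_zero, rlIntegral_eq_cconv one_ne_zero,
        rlIntegral_eq_cconv one_ne_zero] at this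
      rw [this]
      simp [cconv, powKernel_one]
    simp only [hH]
    rw [e1, e2, rlIntegral_mlKernel_one_sub_one hα₀ hα₁ ht]
    ring
  have hHd : ∀ t ∈ Ioo 0 T, HasDerivAt H (A * m t + caputoDeriv α m t) t := by
    intro t ht
    refine (((hasDerivAt_cconv_one hm ht.1).const_mul A).add
      (hd t ht).hasDerivAt).congr_of_eventuallyEq ?_
    filter_upwards [Ioi_mem_nhds ht.1] with v hv
    exact hHeq v hv.le
  have hHanti : AntitoneOn H (Icc 0 T) := by
    refine antitoneOn_of_deriv_nonpos (convex_Icc 0 T) (hHc.mono Icc_subset_Ici_self) ?_ ?_ <;>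
      rw [interior_Icc]
    · exact fun t ht => (hHd t ht).differentiableAt.differentiableWithinAt
    · intro t ht
      rw [(hHd t ht).deriv]
      linarith [hle t ht]
  have hH0 : H 0 = 0 := by
    simp only [hH]
    rw [rlIntegral_apply_zero hy0]
    simp [cconv]
  by_contra hcon
  have hyT : 0 < y T := by simp only [hy]; linarith
  have hev : ∀ᶠ t in 𝓝 T, 0 < y t :=
    (hyc.continuousAt (Ici_mem_nhds hT)).eventually_const_lt hyT
  obtain ⟨η, hη, hball⟩ := Metric.eventually_nhds_iff.1 hev
  set t := max (T - η / 2) 0 with ht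
  have ht0 : 0 ≤ t := le_max_right _ _
  have htT : t < T := max_lt (by linarith) hT
  have hpos : 0 < ∫ u in t..T, y u := by
    refine intervalIntegral.intervalIntegral_pos_of_pos_on ?_ (fun u hu => hball ?_) htT
    · refine ContinuousOn.intervalIntegrable (hyc.mono ?_)
      rw [uIcc_of_le htT.le]
      exact fun u hu => ht0.trans hu.1
    · have : T - η / 2 < u := (le_max_left _ _).trans_lt hu.1
      rw [Real.dist_eq, abs_lt]
      constructor <;> linarith [hu.2]
  have hint : ∀ v, 0 ≤ v → IntervalIntegrable y volume 0 v := fun v hv =>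
    ContinuousOn.intervalIntegrable (hyc.mono (by
      rw [uIcc_of_le hv]; exact Icc_subset_Ici_self))
  have hmono := cconv_mlKernel_antitone hα₀ hα₁ hA (hHc.mono Icc_subset_Ici_self) hHanti hH0 ht0
    htT.le le_rfl
  rw [cconv_mlKernel_relaxation hα₀ hα₁ hT.le hyc, cconv_mlKernel_relaxation hα₀ hα₁ ht0 hyc]
    at hmono
  have := intervalIntegral.integral_interval_sub_left (hint T hT.le) (hint t ht0)
  linarith

/-! ### The barrier argument -/

/-- The decay rate `lam` may be taken so small that `E_α(-lam τ ^ α)` is close to `1`. -/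
theorem exists_small_rate {α τ η : ℝ} (hα₀ : 0 < α) (hα₁ : α ≤ 1) (hτ : 0 ≤ τ) (hη : 0 < η) :
    ∃ lam : ℝ, 0 < lam ∧ lam ≤ η ∧ 1 ≤ (1 + η) * mlKernel α 1 lam τ := by
  set C := powKernel (α + 1) τ
  have hC : 0 ≤ C := powKernel_nonneg (by linarith) hτ
  refine ⟨min η (η / ((1 + η) * (C + 1))), lt_min hη (by positivity), min_le_left _ _, ?_⟩
  set lam := min η (η / ((1 + η) * (C + 1)))
  have hlam : 0 < lam := lt_min hη (by positivity)
  have h1 : lam * ((1 + η) * (C + 1)) ≤ η := by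
    rw [← le_div_iff₀ (by positivity)]
    exact min_le_right _ _
  -- With s_λ(τ) ≥ 1 - λC, the choice of λ makes (1 + η) λ C ≤ η.
  have h2 := one_sub_le_mlKernel_one (A := lam) hα₀ hα₁ hlam.le hτ
  have h3 := mul_le_mul_of_nonneg_left h2 (by linarith : 0 ≤ 1 + η)
  have h4 : 0 ≤ lam * (1 + η) := by positivity
  refine le_trans ?_ h3
  change 1 ≤ (1 + η) * (1 - lam * C)
  linarith

/-- The Caputo derivative ignores the constant d, and s_λ satisfies D^α s_λ = -λ s_λ. -/
theorem SatisfiesHalanay.hasDerivAt_sub {α τ : ℝ} (hα₀ : 0 < α) (hα₁ : α ≤ 1) (hτ : 0 ≤ τ)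
    {a b c q φ w : ℝ → ℝ} (hw : SatisfiesHalanay α τ a b c q φ w) (lam M d : ℝ) {t : ℝ}
    (ht : 0 < t) :
    HasDerivAt (rlIntegral (1 - α) (fun u => (w u - (d + M * mlKernel α 1 lam u)) -
      (w 0 - (d + M * mlKernel α 1 lam 0))))
      (caputoDeriv α w t + M * (lam * mlKernel α 1 lam t)) t := by
  have hs := continuous_mlKernel_one hα₀ hα₁ lam
  have hwc : ContinuousOn w (Ici 0) := hw.continuousOn.mono (Ici_subset_Ici.2 (by linarith))
  have h1 := ((hasDerivAt_cconv_one hs.continuousOn ht).const_mul lam).const_mul M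
  refine ((hw.caputoDifferentiableAt t ht).hasDerivAt.add h1).congr_of_eventuallyEq ?_
  filter_upwards [Ioi_mem_nhds ht] with v hv
  have hlin := rlIntegral_sub_const_mul (sub_nonneg.2 hα₁) (mem_Ioi.1 hv).le
    (x := fun u => w u - w 0) (y := fun u => mlKernel α 1 lam u - 1)
    (hwc.sub continuousOn_const) (hs.continuousOn.sub continuousOn_const) M
  have e : (fun u => (w u - (d + M * mlKernel α 1 lam u)) -
      (w 0 - (d + M * mlKernel α 1 lam 0))) =
      fun u => (w u - w 0) - M * (mlKernel α 1 lam u - 1) := by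
    ext u
    rw [mlKernel_one_zero hα₀]
    ring
  rw [e, hlin, rlIntegral_mlKernel_one_sub_one hα₀ hα₁ hv.le]
  simp [cconv, powKernel_one]

/-- Fractional Halanay inequality under an explicit smallness condition on the rate `lam`. -/
theorem SatisfiesHalanay.le_of_rate {α τ : ℝ} (hα₀ : 0 < α) (hα₁ : α ≤ 1) (hτ : 0 < τ)
    {a b c q φ w : ℝ → ℝ} (ha : ContinuousOn a (Ici 0)) (hb₀ : ∀ t ∈ Ici (0 : ℝ), 0 ≤ b t)
    (hqτ : ∀ t ∈ Ici (0 : ℝ), q t ∈ Icc 0 τ)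
    (hw : SatisfiesHalanay α τ a b c q φ w) {lam w₀ M : ℝ} (hlam : 0 < lam) (hw₀ : 0 ≤ w₀)
    (hM₀ : 0 ≤ M) (hM : ∀ s ∈ Icc (-τ) 0, φ s ≤ M)
    (hrate : ∀ t, 0 ≤ t → lam + b t / mlKernel α 1 lam τ ≤ a t)
    (hc : ∀ t, 0 ≤ t → c t ≤ (a t - b t) * w₀) {t : ℝ} (ht : 0 ≤ t) :
    w t ≤ w₀ + M * mlKernel α 1 lam t := by
  set s := mlKernel α 1 lam with hs
  have hsc : Continuous s := continuous_mlKernel_one hα₀ hα₁ lam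
  have hspos : ∀ t, 0 ≤ t → 0 < s t := fun t ht => mlKernel_one_pos hα₀ hα₁ hlam.le ht
  have hsanti : AntitoneOn s (Ici 0) := mlKernel_one_antitoneOn hα₀ hα₁ hlam.le
  have hs0 : s 0 = 1 := mlKernel_one_zero hα₀ lam
  have hκ := hspos τ hτ.le
  have hκ1 : s τ ≤ 1 := mlKernel_one_le_one hα₀ hα₁ hlam.le hτ.le
  have hwc : ContinuousOn w (Ici 0) := hw.continuousOn.mono (Ici_subset_Ici.2 (by linarith))
  -- The margin ε makes the difference strictly negative at time 0, even if w₀ = 0.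
  refine le_of_forall_pos_le_add fun ε hε => ?_
  set m : ℝ → ℝ := fun u => w u - ((w₀ + ε) + M * s u) with hm
  have hmc : ContinuousOn m (Ici 0) :=
    hwc.sub (continuousOn_const.add (continuousOn_const.mul hsc.continuousOn))
  have hm0 : m 0 < 0 := by
    have h1 : w 0 ≤ M := by
      rw [hw.initial 0 ⟨by linarith, le_rfl⟩]
      exact hM 0 ⟨by linarith, le_rfl⟩
    simp only [hm, hs0]
    linarith
  suffices h : m t < 0 by simp only [hm] at h; linarith
  by_contra hcon
  have hcpt : IsCompact (Icc 0 t ∩ m ⁻¹' Ici 0) := by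
    refine isCompact_Icc.of_isClosed_subset ?_ inter_subset_left
    exact (hmc.mono Icc_subset_Ici_self).preimage_isClosed_of_isClosed isClosed_Icc isClosed_Ici
  obtain ⟨T, ⟨⟨hT0, hTt⟩, hmT⟩, hmin⟩ := hcpt.exists_isLeast ⟨t, ⟨ht, le_rfl⟩, not_lt.1 hcon⟩
  have hmT : 0 ≤ m T := hmT
  have hneg : ∀ u, 0 ≤ u → u < T → m u < 0 := fun u h0 h1 => by
    by_contra h
    exact absurd (hmin ⟨⟨h0, h1.le.trans hTt⟩, not_lt.1 h⟩) (not_le.2 h1)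
  have hT : 0 < T := hT0.lt_of_ne fun h => by rw [← h] at hmT; linarith
  -- A bound for a on [0, T] is enough, so a may be unbounded on the half-line.
  obtain ⟨A, hA⟩ := (isCompact_Icc (a := 0) (b := T)).bddAbove_image
    (ha.mono Icc_subset_Ici_self)
  have hA' : ∀ u ∈ Icc 0 T, a u ≤ A := fun u hu => hA (mem_image_of_mem a hu)
  have hab : ∀ u, 0 ≤ u → b u ≤ b u / s τ := fun u hu => by
    rw [le_div_iff₀ hκ]
    exact mul_le_of_le_one_right (hb₀ u hu) hκ1
  have hA0 : 0 ≤ A := by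
    linarith [hA' 0 ⟨le_rfl, hT.le⟩, hrate 0 le_rfl, hab 0 le_rfl, hb₀ 0 self_mem_Ici]
  have hder := fun u (hu : u ∈ Ioo 0 T) =>
    hw.hasDerivAt_sub hα₀ hα₁ hτ.le lam M (w₀ + ε) hu.1
  have hle : ∀ u ∈ Ioo 0 T, caputoDeriv α m u ≤ -A * m u := by
    intro u hu
    have hu0 : 0 ≤ u := hu.1.le
    have hq := hqτ u hu0
    have hsup : sSup (w '' Icc (u - q u) u) ≤ w₀ + ε + M * (s u / s τ) := by
      refine csSup_le (Nonempty.image _ ⟨u, by linarith [hq.1], le_rfl⟩) ?_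
      rintro _ ⟨x, hx, rfl⟩
      -- For x ≤ 0 the history satisfies φ ≤ M, and u ≤ τ gives s(u)/s(τ) ≥ 1; for x > 0
      -- supermultiplicativity applies.
      rcases le_or_gt x 0 with hx0 | hx0
      · have hxτ : -τ ≤ x := by linarith [hx.1, hq.2]
        rw [hw.initial x ⟨hxτ, hx0⟩]
        have h1 : 1 ≤ s u / s τ := by
          rw [one_le_div hκ]
          exact hsanti hu0 hτ.le (by linarith [hx.1, hq.2])
        have := mul_le_mul_of_nonneg_left h1 hM₀
        linarith [hM x ⟨hxτ, hx0⟩]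
      · have h1 := hneg x hx0.le (hx.2.trans_lt hu.2)
        have h2 : s x ≤ s u / s τ := by
          rw [le_div_iff₀ hκ]
          have h3 := mlKernel_one_mul_le (A := lam) (τ := u - x) hα₀ hα₁ hlam.le
            (by linarith [hx.2]) hx0.le
          rw [add_sub_cancel, ← hs, mul_comm] at h3
          refine le_trans (mul_le_mul_of_nonneg_left ?_ (hspos x hx0.le).le) h3
          exact hsanti (sub_nonneg.2 hx.2) hτ.le (by linarith [hx.1, hq.2])
        have := mul_le_mul_of_nonneg_left h2 hM₀
        simp only [hm] at h1
        linarith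
    have hcap : caputoDeriv α m u = caputoDeriv α w u + M * (lam * s u) := (hder u hu).deriv
    have hwle := hw.caputoDeriv_le u hu.1
    have hmu := hneg u hu0 hu.2
    have hwu : w u = m u + (w₀ + ε + M * s u) := by simp only [hm]; ring
    have h1 := mul_le_mul_of_nonneg_left hsup (hb₀ u hu0)
    have h2 := mul_le_mul_of_nonneg_left (hrate u hu0) (mul_nonneg hM₀ (hspos u hu0).le)
    have h3 : 0 ≤ (a u - b u) * ε :=
      mul_nonneg (by linarith [hrate u hu0, hab u hu0]) hε.le
    have h4 := hc u hu0
    -- Since m(u) < 0, passing from -a m to -A m only increases the right-hand side.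
    have h5 : 0 ≤ (A - a u) * -m u :=
      mul_nonneg (sub_nonneg.2 (hA' u ⟨hu0, hu.2.le⟩)) (by linarith)
    have h6 : b u * (M * (s u / s τ)) = M * s u * (b u / s τ) := by ring
    rw [hcap]
    rw [hwu] at hwle
    linarith
  have hfin := le_mul_mlKernel_one_of_caputoDeriv_le (A := A) hα₀ hα₁ hA0 hT hmc
    (fun u hu => (hder u hu).differentiableAt) hle
  have := mul_neg_of_neg_of_pos hm0 (mlKernel_one_pos (A := A) hα₀ hα₁ hA0 hT.le)
  linarith

theorem le_sSup_abs_image {φ : ℝ → ℝ} {τ : ℝ} (hφ : ContinuousOn φ (Icc (-τ) 0)) :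
    ∀ s ∈ Icc (-τ) 0, φ s ≤ sSup ((fun s => |φ s|) '' Icc (-τ) 0) := fun _ hs =>
  (le_abs_self _).trans (le_csSup (isCompact_Icc.bddAbove_image hφ.abs)
    (mem_image_of_mem (fun s => |φ s|) hs))

theorem sSup_abs_image_nonneg (φ : ℝ → ℝ) (S : Set ℝ) : 0 ≤ sSup ((fun s => |φ s|) '' S) := by
  refine Real.sSup_nonneg ?_
  rintro _ ⟨s, _, rfl⟩
  exact abs_nonneg _

end FracHalanay

end

/-! ### Choice of the rate in the two cases -/

theorem theorem2p4 (α τ : ℝ) (hα₀ : 0 < α) (hα₁ : α ≤ 1) (hτ : 0 < τ)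
    (a b q : ℝ → ℝ)
    (ha : ContinuousOn a (Ici 0)) (ha₀ : ∀ t ∈ Ici (0 : ℝ), 0 ≤ a t)
    (hb : ContinuousOn b (Ici 0)) (hb₀ : ∀ t ∈ Ici (0 : ℝ), 0 ≤ b t)
    (hq : ContinuousOn q (Ici 0)) (hqτ : ∀ t ∈ Ici (0 : ℝ), q t ∈ Icc 0 τ) :
    -- (i): `a` is bounded and `a - b ≥ σ > 0`; then `w₀ = c* / σ`
    (∀ σ : ℝ, 0 < σ → BddAbove (a '' Ici 0) → (∀ t ∈ Ici (0 : ℝ), σ ≤ a t - b t) →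
      ∃ lam : ℝ, 0 < lam ∧
        ∀ (c : ℝ → ℝ) (cstar : ℝ), ContinuousOn c (Ici 0) → (∀ t ∈ Ici (0 : ℝ), 0 ≤ c t) →
          IsLUB (c '' Ici 0) cstar →
        ∀ φ : ℝ → ℝ, ContinuousOn φ (Icc (-τ) 0) → (∀ s ∈ Icc (-τ) 0, 0 ≤ φ s) →
        ∀ w : ℝ → ℝ, FracHalanay.SatisfiesHalanay α τ a b c q φ w →
          ∃ w₀ : ℝ, 0 ≤ w₀ ∧ w₀ = cstar / σ ∧
          ∀ t : ℝ, 0 ≤ t →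
            w t ≤ w₀ + sSup ((fun s => |φ s|) '' Icc (-τ) 0) *
              FracHalanay.mittagLeffler α (-lam * t ^ α)) ∧
    -- (ii): `a ≥ a₀ > 0` and `sup b / a ≤ p < 1`; then `w₀ = c* / ((1 - p) a₀)`
    (∀ a₀ p : ℝ, 0 < a₀ → p < 1 → (∀ t ∈ Ici (0 : ℝ), a₀ ≤ a t) →
        (∀ t ∈ Ici (0 : ℝ), b t / a t ≤ p) →
      ∃ lam : ℝ, 0 < lam ∧
        ∀ (c : ℝ → ℝ) (cstar : ℝ), ContinuousOn c (Ici 0) → (∀ t ∈ Ici (0 : ℝ), 0 ≤ c t) →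
          IsLUB (c '' Ici 0) cstar →
        ∀ φ : ℝ → ℝ, ContinuousOn φ (Icc (-τ) 0) → (∀ s ∈ Icc (-τ) 0, 0 ≤ φ s) →
        ∀ w : ℝ → ℝ, FracHalanay.SatisfiesHalanay α τ a b c q φ w →
          ∃ w₀ : ℝ, 0 ≤ w₀ ∧ w₀ = cstar / ((1 - p) * a₀) ∧
          ∀ t : ℝ, 0 ≤ t →
            w t ≤ w₀ + sSup ((fun s => |φ s|) '' Icc (-τ) 0) *
              FracHalanay.mittagLeffler α (-lam * t ^ α)) := by
  constructor
  · rintro σ hσ ⟨A, hA⟩ hab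
    have hA' : ∀ t, 0 ≤ t → a t ≤ A := fun t ht => hA (mem_image_of_mem a ht)
    have hA₀ : 0 ≤ A := (ha₀ 0 self_mem_Ici).trans (hA' 0 le_rfl)
    -- With λ ≤ η, 1/s_λ(τ) ≤ 1 + η and b ≤ A, λ + b/s_λ(τ) ≤ b + η(1 + A), so η = σ/(1 + A) gives
    -- at most b + σ ≤ a.
    obtain ⟨lam, hlam, hlam_le, hκ⟩ := FracHalanay.exists_small_rate hα₀ hα₁ hτ.le
      (div_pos hσ (by linarith : 0 < 1 + A))
    have hη : σ / (1 + A) * (1 + A) = σ := div_mul_cancel₀ _ (by linarith)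
    have hη₀ : 0 < σ / (1 + A) := by positivity
    set η := σ / (1 + A)
    refine ⟨lam, hlam, fun c cstar _ hc₀ hlub φ hφ _ w hw => ?_⟩
    have hcs : ∀ t, 0 ≤ t → c t ≤ cstar := fun t ht => hlub.1 (mem_image_of_mem c ht)
    have hcs₀ : 0 ≤ cstar := (hc₀ 0 self_mem_Ici).trans (hcs 0 le_rfl)
    refine ⟨cstar / σ, div_nonneg hcs₀ hσ.le, rfl, fun t ht => ?_⟩
    rw [← FracHalanay.mlKernel_one]
    refine hw.le_of_rate hα₀ hα₁ hτ ha hb₀ hqτ hlam (div_nonneg hcs₀ hσ.le)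
      (FracHalanay.sSup_abs_image_nonneg _ _) (FracHalanay.le_sSup_abs_image hφ)
      (fun u hu => ?_) (fun u hu => ?_) ht
    · have hb := hb₀ u hu
      have h1 : b u / FracHalanay.mlKernel α 1 lam τ ≤ b u * (1 + η) := by
        rw [div_le_iff₀ (FracHalanay.mlKernel_one_pos hα₀ hα₁ hlam.le hτ.le), mul_assoc]
        exact le_mul_of_one_le_right hb hκ
      have h2 := mul_le_mul_of_nonneg_right
        (by linarith [hab u hu, hA' u hu] : b u ≤ A) hη₀.le
      linarith [hab u hu]
    · calc c u ≤ σ * (cstar / σ) := by rw [mul_div_cancel₀ _ hσ.ne']; exact hcs u hu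
        _ ≤ _ := mul_le_mul_of_nonneg_right (hab u hu) (div_nonneg hcs₀ hσ.le)
  · intro a₀ p ha₀' hp haa hba
    have hp' : 0 < 1 - p := sub_pos.2 hp
    -- From b ≤ p a and b ≤ a it suffices that η ≤ (1 - p - η) a. This η gives equality at a = a₀,
    -- and η ≤ 1 - p extends it to all a ≥ a₀.
    obtain ⟨lam, hlam, hlam_le, hκ⟩ := FracHalanay.exists_small_rate hα₀ hα₁ hτ.le
      (by positivity : 0 < (1 - p) * a₀ / (1 + a₀))
    have hη : (1 - p) * a₀ / (1 + a₀) * (1 + a₀) = (1 - p) * a₀ :=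
      div_mul_cancel₀ _ (by linarith)
    have hη₀ : 0 < (1 - p) * a₀ / (1 + a₀) := by positivity
    have hη₁ : (1 - p) * a₀ / (1 + a₀) ≤ 1 - p := by
      rw [div_le_iff₀ (by linarith)]
      linarith
    set η := (1 - p) * a₀ / (1 + a₀)
    have hbp : ∀ t, 0 ≤ t → b t ≤ p * a t := fun t ht =>
      (div_le_iff₀ (ha₀'.trans_le (haa t ht))).1 (hba t ht)
    have hD : 0 < (1 - p) * a₀ := by positivity
    refine ⟨lam, hlam, fun c cstar _ hc₀ hlub φ hφ _ w hw => ?_⟩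
    have hcs : ∀ t, 0 ≤ t → c t ≤ cstar := fun t ht => hlub.1 (mem_image_of_mem c ht)
    have hcs₀ : 0 ≤ cstar := (hc₀ 0 self_mem_Ici).trans (hcs 0 le_rfl)
    refine ⟨cstar / ((1 - p) * a₀), div_nonneg hcs₀ hD.le, rfl, fun t ht => ?_⟩
    rw [← FracHalanay.mlKernel_one]
    refine hw.le_of_rate hα₀ hα₁ hτ ha hb₀ hqτ hlam (div_nonneg hcs₀ hD.le)
      (FracHalanay.sSup_abs_image_nonneg _ _) (FracHalanay.le_sSup_abs_image hφ)
      (fun u hu => ?_) (fun u hu => ?_) ht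
    · have hb := hb₀ u hu
      have h1 : b u / FracHalanay.mlKernel α 1 lam τ ≤ b u * (1 + η) := by
        rw [div_le_iff₀ (FracHalanay.mlKernel_one_pos hα₀ hα₁ hlam.le hτ.le), mul_assoc]
        exact le_mul_of_one_le_right hb hκ
      have hau := haa u hu
      have h2 : b u ≤ a u := (hbp u hu).trans (mul_le_of_le_one_left (by linarith) hp.le)
      have h3 := mul_le_mul_of_nonneg_right h2 hη₀.le
      have h4 := mul_le_mul_of_nonneg_left hau (sub_nonneg.2 hη₁)
      linarith [hbp u hu]
    · calc c u ≤ (1 - p) * a₀ * (cstar / ((1 - p) * a₀)) := by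
            rw [mul_div_cancel₀ _ hD.ne']; exact hcs u hu
        _ ≤ _ := by
            refine mul_le_mul_of_nonneg_right ?_ (div_nonneg hcs₀ hD.le)
            have := mul_le_mul_of_nonneg_left (haa u hu) hp'.le
            linarith [hbp u hu]
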